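/- Let $d\ge 0$ and $m,n\ge 1$ be integers. An $m\times n$ net is a collection of points $P_{ij}\in\mathbb{R}^d$ ($0\le i\le m$, $0\le j\le n$) such that for all $0\le i<m$, $0\le j<n$ the points $P_{ij},P_{i+1,j},P_{i+1,j+1},P_{i,j+1}$ are consecutive vertices of a (non-degenerate, strictly) convex quadrilateral, called a face; the sides of the faces are called edges. Faces and edges are labeled by the indices of their vertices and are viewed as distinct if their labels are distinct. An $a\times b$ sub-net consists of the points $P_{ij}$ with $p\le i\le p+a$, $q\le j\le q+b$, for some integers $0\le p\le m-a$, $0\le q\le n-b$. Two $m\times n$ nets are parallel if all their corresponding edges (those with the same labels) are parallel, and congruent if an isometry of $\mathbb{R}^d$ takes each point of the first net to the point of the second net with the same indices. A net is deformable if it belongs to a family of pairwise non-congruent, pairwise parallel $m\times n$ nets with the same areas of corresponding faces, depending continuously on a parameter that runs over a non-degenerate interval of real numbers. Two convex quadrilaterals with a common side are affine symmetric with respect to that side if some affine map takes the first one to the second one and fixes all points of the common side. The opposite ratio of a convex quadrilateral $ABCD$ with respect to its side $AB$ is $\mathrm{Area}(AQB)/\mathrm{Area}(CQD)$, where $Q$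 is the intersection point of the diagonals. Theorem. An $m\times n$ net is deformable if and only if at least one of the following conditions holds: (i) in each $1\times 2$ sub-net the two faces are affine symmetric with respect to their common edge, or in each $2\times 1$ sub-net the two faces are affine symmetric with respect to their common edge; (ii) each pair of faces with a common edge has equal opposite ratios with respect to that edge. -/

import Mathlib

open scoped EuclideanGeometry Affine

noncomputable section

/-- Area of the triangle `ABC`: half the product of two sides and the sine of the angle between. -/
def triangleArea {d : ℕ} (A B C : EuclideanSpace ℝ (Fin d)) : ℝ :=
  dist A B * dist A C * Real.sin (∠ B A C) / 2

/-- `A, B, C, D` are consecutive vertices of a (non-degenerate) convex quadrilateral: the diagonals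
`AC` and `BD` cross at an interior point of both, and the vertices are not on a common line. -/
def IsConvexQuad {d : ℕ} (A B C D : EuclideanSpace ℝ (Fin d)) : Prop :=
  AffineIndependent ℝ ![A, B, C] ∧ (openSegment ℝ A C ∩ openSegment ℝ B D).Nonempty

/-- The convex quadrilateral `ABCD` as a set of points. -/
def quadRegion {d : ℕ} (A B C D : EuclideanSpace ℝ (Fin d)) : Set (EuclideanSpace ℝ (Fin d)) :=
  convexHull ℝ {A, B, C, D}

/-- Area of the convex quadrilateral `ABCD`, which its diagonal `AC` splits into two triangles. -/
def quadArea {d : ℕ} (A B C D : EuclideanSpace ℝ (Fin d)) : ℝ :=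
  triangleArea A B C + triangleArea A C D

/-- The point where the diagonals `AC` and `BD` of a convex quadrilateral `ABCD` meet. -/
def diagonalPoint {d : ℕ} (A B C D : EuclideanSpace ℝ (Fin d)) : EuclideanSpace ℝ (Fin d) :=
  Classical.epsilon fun Q => Q ∈ segment ℝ A C ∧ Q ∈ segment ℝ B D

/-- The opposite ratio of the convex quadrilateral `ABCD` with respect to the side `AB`: the ratio
of the areas of the triangles `AQB` and `CQD`, where the diagonals meet at `Q`. -/
def oppositeRatio {d : ℕ} (A B C D : EuclideanSpace ℝ (Fin d)) : ℝ :=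
  triangleArea A (diagonalPoint A B C D) B / triangleArea C (diagonalPoint A B C D) D

/-- The quadrilaterals `ABCD` and `ABC'D'` are affine symmetric with respect to the common
side `AB`: some affine map takes the first one to the second one and fixes each point of `AB`. -/
def AreAffineSymmetric {d : ℕ} (A B C D C' D' : EuclideanSpace ℝ (Fin d)) : Prop :=
  ∃ f : EuclideanSpace ℝ (Fin d) →ᵃ[ℝ] EuclideanSpace ℝ (Fin d),
    f '' quadRegion A B C D = quadRegion A B C' D' ∧ ∀ X ∈ segment ℝ A B, f X = X

/-- An `m × n` net in `ℝ^d`: points indexed by `{0, …, m} × {0, …, n}` such that for every cell of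
the index grid the four points are consecutive vertices of a convex quadrilateral (a face). -/
structure QuadNet (d m n : ℕ) where
  point : Fin (m + 1) → Fin (n + 1) → EuclideanSpace ℝ (Fin d)
  convex_face : ∀ (i : Fin m) (j : Fin n),
    IsConvexQuad (point i.castSucc j.castSucc) (point i.succ j.castSucc)
      (point i.succ j.succ) (point i.castSucc j.succ)

namespace QuadNet

/-- The area of the face with indices `i, j`. -/
def faceArea {d m n : ℕ} (N : QuadNet d m n) (i : Fin m) (j : Fin n) : ℝ :=
  quadArea (N.point i.castSucc j.castSucc) (N.point i.succ j.castSucc)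
    (N.point i.succ j.succ) (N.point i.castSucc j.succ)

/-- Two nets are parallel (Combescure transformations of each other): all pairs of corresponding
edges are parallel. -/
def IsParallel {d m n : ℕ} (N M : QuadNet d m n) : Prop :=
  (∀ (i : Fin m) (j : Fin (n + 1)),
    line[ℝ, N.point i.castSucc j, N.point i.succ j] ∥
      line[ℝ, M.point i.castSucc j, M.point i.succ j]) ∧
  (∀ (i : Fin (m + 1)) (j : Fin n),
    line[ℝ, N.point i j.castSucc, N.point i j.succ] ∥
      line[ℝ, M.point i j.castSucc, M.point i j.succ])

/-- Two nets are congruent: an isometry of `ℝ^d` takes each point of the first net to the point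
of the second one with the same indices. -/
def IsCongruent {d m n : ℕ} (N M : QuadNet d m n) : Prop :=
  ∃ g : EuclideanSpace ℝ (Fin d) ≃ᵢ EuclideanSpace ℝ (Fin d),
    ∀ i j, g (N.point i j) = M.point i j

/-- A net is deformable: it is a member of a continuous family, parametrized by a non-degenerate
real interval, of pairwise non-congruent parallel nets with the same areas of corresponding
faces. -/
def IsDeformable {d m n : ℕ} (N : QuadNet d m n) : Prop :=
  ∃ (I : Set ℝ) (F : I → QuadNet d m n),
    I.OrdConnected ∧ I.Nontrivial ∧
    (∃ t₀ : I, F t₀ = N) ∧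
    (∀ i j, Continuous fun t : I => (F t).point i j) ∧
    (∀ s t : I, (F s).IsParallel (F t)) ∧
    (∀ s t : I, ∀ i j, (F s).faceArea i j = (F t).faceArea i j) ∧
    (∀ s t : I, s ≠ t → ¬ (F s).IsCongruent (F t))

/-- The `a × b` sub-net with the points whose indices are `p, …, p + a` and `q, …, q + b`. -/
def subnet {d m n : ℕ} (N : QuadNet d m n) (a b p q : ℕ) (hp : p + a ≤ m) (hq : q + b ≤ n) :
    QuadNet d a b where
  point i j := N.point ⟨p + i, by omega⟩ ⟨q + j, by omega⟩
  convex_face i j := N.convex_face ⟨p + i, by omega⟩ ⟨q + j, by omega⟩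

/-- The two faces of a `1 × 2` net are affine symmetric with respect to their common edge, whose
endpoints have the indices `0, 1` and `1, 1`. -/
def AffineSymmetricOneTwo {d : ℕ} (N : QuadNet d 1 2) : Prop :=
  AreAffineSymmetric (N.point 0 1) (N.point 1 1)
    (N.point 1 0) (N.point 0 0) (N.point 1 2) (N.point 0 2)

/-- The two faces of a `2 × 1` net are affine symmetric with respect to their common edge, whose
endpoints have the indices `1, 0` and `1, 1`. -/
def AffineSymmetricTwoOne {d : ℕ} (N : QuadNet d 2 1) : Prop :=
  AreAffineSymmetric (N.point 1 0) (N.point 1 1)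
    (N.point 0 1) (N.point 0 0) (N.point 2 1) (N.point 2 0)

/-- The two faces of a `1 × 2` net have equal opposite ratios with respect to their common edge. -/
def EqualOppositeRatiosOneTwo {d : ℕ} (N : QuadNet d 1 2) : Prop :=
  oppositeRatio (N.point 0 1) (N.point 1 1) (N.point 1 0) (N.point 0 0) =
    oppositeRatio (N.point 0 1) (N.point 1 1) (N.point 1 2) (N.point 0 2)

/-- The two faces of a `2 × 1` net have equal opposite ratios with respect to their common edge. -/
def EqualOppositeRatiosTwoOne {d : ℕ} (N : QuadNet d 2 1) : Prop :=
  oppositeRatio (N.point 1 0) (N.point 1 1) (N.point 0 1) (N.point 0 0) =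
    oppositeRatio (N.point 1 0) (N.point 1 1) (N.point 2 1) (N.point 2 0)

end QuadNet

end

/-! Up to affine maps a convex quadrilateral `ABCD` has two moduli `h`, `v`: its diagonals divide
each other in the ratios `h * v` and `h / v`. Consider quadrilaterals with sides parallel to those
of `ABCD`, positive scale factors and the same area. The two closing equations and the area equation
put the four factors on a hyperbola: they are `P + h S`, `P + S / h`, `P - v S`, `P - S / v` with
`P² - S² = 1`. With `z = P + S > 0` these are the values of `sideScale`
(`HasQuadShape.exists_param`, conversely `HasQuadShape.of_param`). A deformation thus amounts to one
function `z` per face, such that the two faces at an inner edge assign it the same factor. The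
opposite ratio with respect to `AB` is `1 / h ^ 2`, so equal ratios at an edge mean that the
coefficients of `S` on its two sides coincide; affine symmetry says that the other modulus agrees as
well.

Sufficiency: with equal opposite ratios everywhere, a single `z` serves all faces. With affine
symmetry in one direction, `z` may be constant in that direction; in the other it is found by
solving one quadratic equation after another near `z = 1` (`exists_param_chain`).
`QuadNet.isDeformable_of_params` assembles the nets.

Necessity: four faces meet at an inner vertex. If the coefficients differ at two consecutive edges,
the factors of the other two edges are expressed through square roots of polynomials in `z ^ 2`, or
rationally in degenerate cases. The fourth face imposes a quadratic relation between these two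
factors, which is impossible because the roots are independent over rational functions
(`not_biquadratic_relation`, `eq_or_eq_of_linked`). Hence the coefficients match at two opposite
edges, the parameters across these edges coincide, and comparing the other two edges gives
`vertex_trichotomy`. `grid_trichotomy` makes the alternative global. -/

/-! ### Coordinates with respect to two independent vectors. -/

section PlaneCoordinates

variable {V : Type*} [AddCommGroup V] [Module ℝ V]

theorem LinearIndependent.pair_coords_eq {x y : V} (h : LinearIndependent ℝ ![x, y])
    {p q r s : ℝ} (e : p • x + q • y = r • x + s • y) : p = r ∧ q = s := by
  have h0 : (p - r) • x + (q - s) • y = 0 := by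
    rw [sub_smul, sub_smul, ← sub_eq_zero.2 e]; abel
  obtain ⟨h1, h2⟩ := LinearIndependent.pair_iff.1 h _ _ h0
  exact ⟨sub_eq_zero.1 h1, sub_eq_zero.1 h2⟩

theorem LinearIndependent.pair_of_det_ne_zero {x y : V} (h : LinearIndependent ℝ ![x, y])
    {p q r s : ℝ} (hd : p * s - q * r ≠ 0) :
    LinearIndependent ℝ ![p • x + q • y, r • x + s • y] := by
  rw [LinearIndependent.pair_iff]
  intro a b hab
  have h0 : (a * p + b * r) • x + (a * q + b * s) • y = 0 := by
    rw [← hab]; module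
  obtain ⟨h1, h2⟩ := LinearIndependent.pair_iff.1 h _ _ h0
  constructor
  · have : a * (p * s - q * r) = 0 := by linear_combination s * h1 - r * h2
    exact (mul_eq_zero.1 this).resolve_right hd
  · have : b * (p * s - q * r) = 0 := by linear_combination p * h2 - q * h1
    exact (mul_eq_zero.1 this).resolve_right hd

theorem affineIndependent_triple_iff {A B C : V} :
    AffineIndependent ℝ ![A, B, C] ↔ LinearIndependent ℝ ![B - A, C - A] := by
  rw [LinearIndependent.pair_iff, affineIndependent_iff]
  constructor
  · intro h s t e
    have := h Finset.univ ![-s - t, s, t] (by simp [Fin.sum_univ_three]; ring) (by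
      simp only [Fin.sum_univ_three, Matrix.cons_val_zero, Matrix.cons_val_one, Matrix.cons_val]
      rw [← e]; module)
    exact ⟨by simpa using this 1 (Finset.mem_univ _), by simpa using this 2 (Finset.mem_univ _)⟩
  · intro h S w hw e
    have hw' : ∑ i, (if i ∈ S then w i else 0) = 0 := by simpa using hw
    have e' : ∑ i, (if i ∈ S then w i else 0) • ![A, B, C] i = 0 := by
      simpa only [ite_smul, zero_smul, Finset.sum_ite_mem, Finset.univ_inter] using e
    set u : Fin 3 → ℝ := fun i => if i ∈ S then w i else 0 with hu
    have hsum : u 0 + u 1 + u 2 = 0 := by simpa [Fin.sum_univ_three] using hw'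
    have hcomb : u 0 • A + u 1 • B + u 2 • C = 0 := by rwa [Fin.sum_univ_three] at e'
    have h0 : u 1 • (B - A) + u 2 • (C - A) = 0 := by
      rw [← hcomb, show u 0 = -u 1 - u 2 by linarith]; module
    obtain ⟨h1, h2⟩ := h _ _ h0
    have hall : ∀ i, u i = 0 := by
      intro i
      fin_cases i
      · simpa [h1, h2] using hsum
      · exact h1
      · exact h2
    intro i hi
    simpa [hu, hi] using hall i

end PlaneCoordinates

/-! ### Areas of parallelograms. -/

section Wedge

variable {V : Type*} [NormedAddCommGroup V] [InnerProductSpace ℝ V]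

/-- Area of the parallelogram spanned by two vectors. -/
noncomputable def wedgeNorm (x y : V) : ℝ :=
  Real.sin (InnerProductGeometry.angle x y) * (‖x‖ * ‖y‖)

theorem wedgeNorm_pos {x y : V} (h : LinearIndependent ℝ ![x, y]) : 0 < wedgeNorm x y := by
  have hx : x ≠ 0 := h.ne_zero 0
  have hy : y ≠ 0 := h.ne_zero 1
  have hs : 0 < Real.sin (InnerProductGeometry.angle x y) := by
    refine lt_of_le_of_ne (InnerProductGeometry.sin_angle_nonneg x y) (Ne.symm ?_)
    rw [Ne, InnerProductGeometry.sin_eq_zero_iff_angle_eq_zero_or_angle_eq_pi,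
      InnerProductGeometry.angle_eq_zero_iff, InnerProductGeometry.angle_eq_pi_iff]
    rw [LinearIndependent.pair_iff] at h
    rintro (⟨-, r, -, e⟩ | ⟨-, r, -, e⟩) <;>
    · have := (h r (-1) (by rw [e]; module)).2
      norm_num at this
  have := norm_pos_iff.2 hx
  have := norm_pos_iff.2 hy
  unfold wedgeNorm
  positivity

/-- The area is the square root of the Gram determinant, which a linear substitution multiplies by
the square of its determinant. -/
theorem wedgeNorm_comb (x y : V) (p q r s : ℝ) :
    wedgeNorm (p • x + q • y) (r • x + s • y) = |p * s - q * r| * wedgeNorm x y := by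
  unfold wedgeNorm
  rw [InnerProductGeometry.sin_angle_mul_norm_mul_norm,
    InnerProductGeometry.sin_angle_mul_norm_mul_norm, ← Real.sqrt_sq_eq_abs,
    ← Real.sqrt_mul (sq_nonneg _)]
  congr 1
  simp only [inner_add_left, inner_add_right, real_inner_smul_left, real_inner_smul_right,
    real_inner_comm x y]
  ring

end Wedge

/-! ### Shape and area-preserving parallel deformations of one face. -/

section Face

variable {d : ℕ}

local notation "E" => EuclideanSpace ℝ (Fin d)

theorem triangleArea_eq_wedgeNorm (A B C : E) :
    triangleArea A B C = wedgeNorm (B - A) (C - A) / 2 := by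
  unfold triangleArea wedgeNorm EuclideanGeometry.angle
  rw [dist_comm A B, dist_comm A C, dist_eq_norm, dist_eq_norm, vsub_eq_sub, vsub_eq_sub]
  ring

theorem triangleArea_eq {A B C x y : E} {p q r s : ℝ} (h1 : B - A = p • x + q • y)
    (h2 : C - A = r • x + s • y) :
    triangleArea A B C = |p * s - q * r| * wedgeNorm x y / 2 := by
  rw [triangleArea_eq_wedgeNorm, h1, h2, wedgeNorm_comb]

/-- Normal form of a convex quadrilateral `ABCD`: with the origin `Q` at the intersection of the
diagonals, `C = -(h v) A` and `D = -(h / v) B`. -/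
def IsQuadFrame (A B C D : E) (h v : ℝ) (Q x y : E) : Prop :=
  LinearIndependent ℝ ![x, y] ∧ A = Q + x ∧ B = Q + y ∧ C = Q - (h * v) • x ∧
    D = Q - (h / v) • y

/-- The affine shape of a convex quadrilateral is recorded by two positive numbers. -/
def HasQuadShape (A B C D : E) (h v : ℝ) : Prop :=
  0 < h ∧ 0 < v ∧ ∃ Q x y, IsQuadFrame A B C D h v Q x y

theorem IsConvexQuad.exists_shape {A B C D : E} (hq : IsConvexQuad A B C D) :
    ∃ h v, HasQuadShape A B C D h v := by
  obtain ⟨hi, Q, ⟨a, b, ha, hb, hab, hQ⟩, ⟨c, e, hc, he, hce, hQ'⟩⟩ := hq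
  rw [affineIndependent_triple_iff] at hi
  have hli : LinearIndependent ℝ ![A - Q, B - Q] := by
    have := hi.pair_of_det_ne_zero (p := 0) (q := -b) (r := 1) (s := -b) (by simpa using hb.ne')
    convert this using 2
    · rw [← hQ, show a = 1 - b by linarith]; module
    · congr 1
      rw [← hQ, show a = 1 - b by linarith]; module
  -- `Q` divides the diagonals in the ratios `a / b` and `c / e`; the two square roots solve `h * v
  -- = a / b`, `h / v = c / e`.
  have hγ : √(a / b * (c / e)) * √(a / b / (c / e)) = a / b := by
    rw [← Real.sqrt_mul (by positivity), show a / b * (c / e) * (a / b / (c / e)) = (a / b) ^ 2 by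
      field_simp, Real.sqrt_sq (by positivity)]
  have hδ : √(a / b * (c / e)) / √(a / b / (c / e)) = c / e := by
    rw [← Real.sqrt_div (by positivity), show a / b * (c / e) / (a / b / (c / e)) = (c / e) ^ 2 by
      field_simp, Real.sqrt_sq (by positivity)]
  refine ⟨√(a / b * (c / e)), √(a / b / (c / e)), by positivity, by positivity, Q, A - Q, B - Q,
    hli, by abel, by abel, ?_, ?_⟩
  · rw [hγ]
    have : b • C = b • (Q - (a / b) • (A - Q)) := by
      rw [smul_sub, smul_smul, mul_div_cancel₀ _ hb.ne', eq_sub_of_add_eq' hQ,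
        show b = 1 - a by linarith]
      module
    exact smul_right_injective _ hb.ne' this
  · rw [hδ]
    have : e • D = e • (Q - (c / e) • (B - Q)) := by
      rw [smul_sub, smul_smul, mul_div_cancel₀ _ he.ne', eq_sub_of_add_eq' hQ',
        show e = 1 - c by linarith]
      module
    exact smul_right_injective _ he.ne' this

/-- Relabelling vertices keeps `Q` and only rescales the frame. With `reflect` and `flip`, this
transfers every fact about the side `AB` to the other sides. -/
theorem HasQuadShape.rotate {A B C D : E} {h v : ℝ} (H : HasQuadShape A B C D h v) :
    HasQuadShape B C D A (1 / v) h := by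
  obtain ⟨hh, hv, Q, x, y, hli, rfl, rfl, rfl, rfl⟩ := H
  refine ⟨by positivity, hh, Q, y, -(h * v) • x, ?_, rfl, ?_, ?_, ?_⟩
  · have := hli.pair_of_det_ne_zero (p := 0) (q := 1) (r := -(h * v)) (s := 0)
      (by simp; constructor <;> positivity)
    simpa using this
  · module
  · rw [one_div_mul_eq_div]
  · rw [smul_smul, show 1 / v / h * -(h * v) = -1 by field_simp]; module

theorem HasQuadShape.reflect {A B C D : E} {h v : ℝ} (H : HasQuadShape A B C D h v) :
    HasQuadShape A D C B v h := by
  obtain ⟨hh, hv, Q, x, y, hli, rfl, rfl, rfl, rfl⟩ := H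
  refine ⟨hv, hh, Q, x, -(h / v) • y, ?_, rfl, ?_, ?_, ?_⟩
  · have := hli.pair_of_det_ne_zero (p := 1) (q := 0) (r := 0) (s := -(h / v))
      (by simp; constructor <;> positivity)
    simpa using this
  · module
  · rw [mul_comm]
  · rw [smul_smul, show v / h * -(h / v) = -1 by field_simp]; module

theorem HasQuadShape.flip {A B C D : E} {h v : ℝ} (H : HasQuadShape A B C D h v) :
    HasQuadShape D C B A (1 / h) v := by
  simpa using H.reflect.rotate

theorem IsQuadFrame.diagonalPoint_eq {A B C D Q x y : E} {h v : ℝ} (hh : 0 < h) (hv : 0 < v)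
    (H : IsQuadFrame A B C D h v Q x y) : diagonalPoint A B C D = Q := by
  obtain ⟨hli, rfl, rfl, rfl, rfl⟩ := H
  have hex : ∃ R, R ∈ segment ℝ (Q + x) (Q - (h * v) • x) ∧
      R ∈ segment ℝ (Q + y) (Q - (h / v) • y) := by
    refine ⟨Q, ⟨h * v / (1 + h * v), 1 / (1 + h * v), by positivity, by positivity, ?_, ?_⟩,
      ⟨(h / v) / (1 + h / v), 1 / (1 + h / v), by positivity, by positivity, ?_, ?_⟩⟩
    · rw [← add_div, add_comm, div_self (by positivity)]
    · rw [show h * v / (1 + h * v) = h * v * (1 / (1 + h * v)) by ring]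
      have : (1 : ℝ) = (1 + h * v) * (1 / (1 + h * v)) := by field_simp
      rw [← sub_eq_zero]
      calc _ = ((1 + h * v) * (1 / (1 + h * v)) - 1) • Q := by module
        _ = 0 := by rw [← this]; simp
    · rw [← add_div, add_comm, div_self (by positivity)]
    · rw [show h / v / (1 + h / v) = h / v * (1 / (1 + h / v)) by ring]
      have : (1 : ℝ) = (1 + h / v) * (1 / (1 + h / v)) := by field_simp
      rw [← sub_eq_zero]
      calc _ = ((1 + h / v) * (1 / (1 + h / v)) - 1) • Q := by module
        _ = 0 := by rw [← this]; simp
  obtain ⟨⟨a, b, ha, hb, hab, h1⟩, ⟨c, e, hc, he, hce, h2⟩⟩ := Classical.epsilon_spec hex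
  change a • (Q + x) + b • (Q - (h * v) • x) = diagonalPoint _ _ _ _ at h1
  change c • (Q + y) + e • (Q - (h / v) • y) = diagonalPoint _ _ _ _ at h2
  have h3 : (a - b * (h * v)) • x + (0 : ℝ) • y = (0 : ℝ) • x + (c - e * (h / v)) • y := by
    have h12 := h1.trans h2.symm
    obtain rfl : a = 1 - b := by linarith
    obtain rfl : c = 1 - e := by linarith
    rw [← sub_eq_zero] at h12 ⊢
    rw [← h12]; module
  have h4 := (hli.pair_coords_eq h3).1
  rw [← h1]
  calc _ = (a + b) • Q + (a - b * (h * v)) • x := by module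
    _ = Q := by rw [hab, h4]; simp

theorem HasQuadShape.oppositeRatio_eq {A B C D : E} {h v : ℝ} (H : HasQuadShape A B C D h v) :
    oppositeRatio A B C D = 1 / h ^ 2 := by
  obtain ⟨hh, hv, Q, x, y, hF⟩ := H
  have hQ := hF.diagonalPoint_eq hh hv
  obtain ⟨hli, rfl, rfl, rfl, rfl⟩ := hF
  have hw := wedgeNorm_pos hli
  unfold oppositeRatio
  rw [hQ, triangleArea_eq (x := x) (y := y) (p := -1) (q := 0) (r := -1) (s := 1) (by module)
    (by module), triangleArea_eq (x := x) (y := y) (p := h * v) (q := 0) (r := h * v)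
    (s := -(h / v)) (by module) (by module)]
  rw [show h * v * -(h / v) - 0 * (h * v) = -h ^ 2 by field_simp; ring, abs_neg,
    abs_of_pos (by positivity : 0 < h ^ 2)]
  norm_num
  field_simp

/-- The scale factor of a side in a deformation of a quadrilateral with parameter `z`. -/
noncomputable def sideScale (c z : ℝ) : ℝ := ((1 + c) * z + (1 - c) / z) / 2

/-- The angles at `B` and `D` are unchanged, so the triangles `ABC` and `ACD` have their areas
multiplied by `a₁ * b₂` and `a₂ * b₁`. -/
theorem IsQuadFrame.quadArea_eq {A B C D Q x y A' B' C' D' : E} {h v a₁ a₂ b₁ b₂ : ℝ}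
    (hh : 0 < h) (hv : 0 < v) (H : IsQuadFrame A B C D h v Q x y)
    (ha₁ : 0 < a₁) (ha₂ : 0 < a₂) (hb₁ : 0 < b₁) (hb₂ : 0 < b₂)
    (e₁ : B' - A' = a₁ • (B - A)) (e₂ : C' - D' = a₂ • (C - D)) (e₃ : D' - A' = b₁ • (D - A))
    (e₄ : C' - B' = b₂ • (C - B)) :
    quadArea A' B' C' D' =
      (a₁ * b₂ + a₂ * b₁ * (h / v)) * ((1 + h * v) * wedgeNorm x y / 2) := by
  obtain ⟨hli, rfl, rfl, rfl, rfl⟩ := H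
  unfold quadArea
  rw [triangleArea_eq (x := x) (y := y) (A := A') (p := -a₁) (q := a₁) (r := -a₁ - b₂ * (h * v))
      (s := a₁ - b₂) (by rw [e₁]; module)
      (by rw [← sub_add_sub_cancel C' B' A', e₁, e₄]; module),
    triangleArea_eq (x := x) (y := y) (A := A') (p := -b₁ - a₂ * (h * v))
      (q := -b₁ * (h / v) + a₂ * (h / v)) (r := -b₁) (s := -b₁ * (h / v))
      (by rw [← sub_add_sub_cancel C' D' A', e₂, e₃]; module)
      (by rw [e₃]; module),
    show -a₁ * (a₁ - b₂) - a₁ * (-a₁ - b₂ * (h * v)) = a₁ * b₂ * (1 + h * v) by ring,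
    show (-b₁ - a₂ * (h * v)) * (-b₁ * (h / v)) - (-b₁ * (h / v) + a₂ * (h / v)) * -b₁
      = a₂ * b₁ * (h / v) * (1 + h * v) by ring,
    abs_of_pos (by positivity : 0 < a₁ * b₂ * (1 + h * v)),
    abs_of_pos (by positivity : 0 < a₂ * b₁ * (h / v) * (1 + h * v))]
  ring

theorem IsQuadFrame.quadArea_self {A B C D Q x y : E} {h v : ℝ}
    (hh : 0 < h) (hv : 0 < v) (H : IsQuadFrame A B C D h v Q x y) :
    quadArea A B C D = (1 + h / v) * ((1 + h * v) * wedgeNorm x y / 2) := by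
  simpa using H.quadArea_eq hh hv one_pos one_pos one_pos one_pos (A' := A) (B' := B) (C' := C)
    (D' := D) (by simp) (by simp) (by simp) (by simp)

/-- Closing up costs two linear conditions on the four factors. In suitable coordinates `P`, `S` on
the remaining plane the area condition reads `P ^ 2 - S ^ 2 = 1`, and positivity selects the branch
`P > 0`, parametrized by `z = P + S`. -/
theorem HasQuadShape.exists_param {A B C D A' B' C' D' : E} {h v a₁ a₂ b₁ b₂ : ℝ}
    (H : HasQuadShape A B C D h v) (ha₁ : 0 < a₁) (ha₂ : 0 < a₂) (hb₁ : 0 < b₁) (hb₂ : 0 < b₂)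
    (e₁ : B' - A' = a₁ • (B - A)) (e₂ : C' - D' = a₂ • (C - D)) (e₃ : D' - A' = b₁ • (D - A))
    (e₄ : C' - B' = b₂ • (C - B)) (hA : quadArea A' B' C' D' = quadArea A B C D) :
    ∃ z, 0 < z ∧ a₁ = sideScale h z ∧ a₂ = sideScale (1 / h) z ∧ b₁ = sideScale (-v) z ∧
      b₂ = sideScale (-(1 / v)) z := by
  obtain ⟨hh, hv, Q, x, y, hF⟩ := H
  rw [hF.quadArea_eq hh hv ha₁ ha₂ hb₁ hb₂ e₁ e₂ e₃ e₄, hF.quadArea_self hh hv] at hA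
  obtain ⟨hli, rfl, rfl, rfl, rfl⟩ := hF
  have hw := wedgeNorm_pos hli
  have hA' : a₁ * b₂ + a₂ * b₁ * (h / v) = 1 + h / v :=
    mul_right_cancel₀ (by positivity : (1 + h * v) * wedgeNorm x y / 2 ≠ 0) hA
  have hcl : (-a₁ - b₂ * (h * v)) • x + (a₁ - b₂) • y =
      (-b₁ - a₂ * (h * v)) • x + (-b₁ * (h / v) + a₂ * (h / v)) • y := by
    have : a₁ • (Q + y - (Q + x)) + b₂ • (Q - (h * v) • x - (Q + y)) =
        b₁ • (Q - (h / v) • y - (Q + x)) + a₂ • (Q - (h * v) • x - (Q - (h / v) • y)) := by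
      rw [← e₁, ← e₂, ← e₃, ← e₄]; abel
    rw [← sub_eq_zero] at this ⊢
    rw [← this]; module
  obtain ⟨c₁, c₂⟩ := hli.pair_coords_eq hcl
  -- `P` and `S` are the solution of `a₁ = P + h * S`, `b₁ = P - v * S`.
  obtain ⟨S, hS⟩ : ∃ S, S = (a₁ - b₁) / (h + v) := ⟨_, rfl⟩
  obtain ⟨P, hP⟩ : ∃ P, P = (v * a₁ + h * b₁) / (h + v) := ⟨_, rfl⟩
  have k₁ : a₁ = P + h * S := by rw [hP, hS]; field_simp; ring
  have k₃ : b₁ = P - v * S := by rw [hP, hS]; field_simp; ring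
  have c₂' : v * (a₁ - b₂) = h * (a₂ - b₁) := by
    field_simp at c₂; linarith
  have k₂ : h * a₂ = h * P + S := by
    have : (h + v) * (h * a₂) = (h + v) * (h * P + S) := by
      rw [k₁, k₃] at c₁ c₂'
      linear_combination c₁ - h * c₂'
    exact mul_left_cancel₀ (by positivity) this
  have k₄ : v * b₂ = v * P - S := by
    have : h * (v * b₂) = h * (v * P - S) := by
      rw [k₁, k₃] at c₁ 
      linear_combination - c₁ + v * k₂
    exact mul_left_cancel₀ hh.ne' this
  have hPS : P ^ 2 - S ^ 2 = 1 := by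
    have : v * (a₁ * b₂ + a₂ * b₁ * (h / v)) = v * (1 + h / v) := by rw [hA']
    have h2 : a₁ * (v * b₂) + b₁ * (h * a₂) = v + h := by
      field_simp at this; linarith
    rw [k₂, k₄, k₁, k₃] at h2
    have : (v + h) * (P ^ 2 - S ^ 2) = (v + h) * 1 := by linear_combination h2
    exact mul_left_cancel₀ (by positivity) this
  have hPpos : 0 < P := by rw [hP]; positivity
  have hz : 0 < P + S := by nlinarith
  have hzi : (P + S)⁻¹ = P - S := inv_eq_of_mul_eq_one_right (by linarith)
  refine ⟨P + S, hz, ?_, ?_, ?_, ?_⟩ <;> unfold sideScale <;> rw [div_eq_mul_inv _ (P + S), hzi]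
  · rw [k₁]; ring
  · apply mul_left_cancel₀ hh.ne'; rw [k₂]; field_simp; ring
  · rw [k₃]; ring
  · apply mul_left_cancel₀ hv.ne'; rw [k₄]; field_simp; ring

theorem HasQuadShape.of_param {A B C D A' B' C' D' : E} {h v z : ℝ}
    (H : HasQuadShape A B C D h v) (hz : 0 < z)
    (ha₁ : 0 < sideScale h z) (ha₂ : 0 < sideScale (1 / h) z)
    (hb₁ : 0 < sideScale (-v) z) (hb₂ : 0 < sideScale (-(1 / v)) z)
    (e₁ : B' - A' = sideScale h z • (B - A)) (e₂ : C' - D' = sideScale (1 / h) z • (C - D))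
    (e₃ : D' - A' = sideScale (-v) z • (D - A))
    (e₄ : C' - B' = sideScale (-(1 / v)) z • (C - B)) :
    IsConvexQuad A' B' C' D' ∧ quadArea A' B' C' D' = quadArea A B C D := by
  obtain ⟨hh, hv, Q, x, y, hF⟩ := H
  have hF' := hF
  obtain ⟨hli, rfl, rfl, rfl, rfl⟩ := hF'
  obtain ⟨P, hP⟩ : ∃ P, P = (z + z⁻¹) / 2 := ⟨_, rfl⟩
  obtain ⟨S, hS⟩ : ∃ S, S = (z - z⁻¹) / 2 := ⟨_, rfl⟩
  have hPS : P ^ 2 - S ^ 2 = 1 := by rw [hP, hS]; field_simp; ring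
  have hL : ∀ c, sideScale c z = P + c * S := by
    intro c; rw [hP, hS]; unfold sideScale; rw [div_eq_mul_inv _ z]; ring
  have harea := hF.quadArea_eq hh hv ha₁ ha₂ hb₁ hb₂ e₁ e₂ e₃ e₄
  rw [hL] at e₁ e₂ e₃ e₄ ha₁ ha₂ hb₁ hb₂
  simp only [hL] at harea
  have hca : B' - A' = -(P + h * S) • x + (P + h * S) • y := by rw [e₁]; module
  have hcb : C' - A' = -(P * (1 + h * v)) • x + (S * (h + 1 / v)) • y := by
    rw [← sub_add_sub_cancel C' B' A', e₁, e₄]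
    have e : P * (1 + h * v) = (P + h * S) + (P + -(1 / v) * S) * (h * v) := by field_simp; ring
    rw [e]; module
  have hcd : D' - B' = (S * (h + v)) • x + -(P * (1 + h / v)) • y := by
    rw [← sub_sub_sub_cancel_right D' B' A', e₁, e₃]
    have e : P * (1 + h / v) = (P + h * S) + (P + -v * S) * (h / v) := by field_simp; ring
    rw [e]; module
  -- The weight of each vertex at the crossing point is the share of the total area taken by the
  -- triangle of the other diagonal's endpoints and the opposite vertex. So the weights are products
  -- of adjacent side factors, and they sum to 1 because `P ^ 2 - S ^ 2 = 1`.
  refine ⟨⟨?_, A' + ((P + h * S) * (P + -v * S) / (1 + h * v)) • (C' - A'),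
    ⟨h * v * (P + -(1 / v) * S) * (P + 1 / h * S) / (1 + h * v),
      (P + h * S) * (P + -v * S) / (1 + h * v), by positivity, by positivity, ?_, ?_⟩,
    ⟨h * (P + 1 / h * S) * (P + -v * S) / (h + v), v * (P + h * S) * (P + -(1 / v) * S) / (h + v),
      by positivity, by positivity, ?_, ?_⟩⟩, ?_⟩
  · rw [affineIndependent_triple_iff, hca, hcb]
    apply hli.pair_of_det_ne_zero
    have e : -(P + h * S) * (S * (h + 1 / v)) - (P + h * S) * -(P * (1 + h * v)) =
        (P + h * S) * ((1 + h * v) * (P + -(1 / v) * S)) := by field_simp; ring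
    rw [e]; positivity
  · field_simp; linear_combination (1 + h * v) * hPS
  · rw [show h * v * (P + -(1 / v) * S) * (P + 1 / h * S) / (1 + h * v) =
      1 - (P + h * S) * (P + -v * S) / (1 + h * v) by
        field_simp; linear_combination (1 + h * v) * hPS]
    module
  · field_simp; linear_combination (h + v) * hPS
  · rw [show h * (P + 1 / h * S) * (P + -v * S) / (h + v) =
      1 - v * (P + h * S) * (P + -(1 / v) * S) / (h + v) by
        field_simp; linear_combination (h + v) * hPS]
    have : B' + (v * (P + h * S) * (P + -(1 / v) * S) / (h + v)) • (D' - B') =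
        A' + ((P + h * S) * (P + -v * S) / (1 + h * v)) • (C' - A') := by
      rw [← sub_eq_zero]
      have e : B' + (v * (P + h * S) * (P + -(1 / v) * S) / (h + v)) • (D' - B') -
        (A' + ((P + h * S) * (P + -v * S) / (1 + h * v)) • (C' - A')) = (B' - A') +
        (v * (P + h * S) * (P + -(1 / v) * S) / (h + v)) • (D' - B') -
        ((P + h * S) * (P + -v * S) / (1 + h * v)) • (C' - A') := by abel
      rw [e, hca, hcb, hcd]
      have f₁ : -(P + h * S) + v * (P + h * S) * (P + -(1 / v) * S) / (h + v) * (S * (h + v)) +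
          (P + h * S) * (P + -v * S) / (1 + h * v) * (P * (1 + h * v)) = 0 := by
        field_simp
        linear_combination (P + h * S) * hPS
      have f₂ : (P + h * S) - v * (P + h * S) * (P + -(1 / v) * S) / (h + v) * (P * (1 + h / v)) -
          (P + h * S) * (P + -v * S) / (1 + h * v) * (S * (h + 1 / v)) = 0 := by
        have g₁ : v * (P + h * S) * (P + -(1 / v) * S) / (h + v) * (P * (1 + h / v)) =
            (P + h * S) * P * (P + -(1 / v) * S) := by field_simp; ring
        have g₂ : (P + h * S) * (P + -v * S) / (1 + h * v) * (S * (h + 1 / v)) =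
            (P + h * S) * (P + -v * S) * S / v := by field_simp; ring
        rw [g₁, g₂]
        field_simp
        linear_combination (-(P + h * S) * v) * hPS
      have hcomb : ∀ r s : ℝ, r = 0 → s = 0 → r • x + s • y = 0 := by
        rintro _ _ rfl rfl; simp
      refine Eq.trans ?_ (hcomb _ _ f₁ f₂)
      module
    rw [← this]; module
  · rw [harea, hF.quadArea_self hh hv]
    congr 1
    field_simp
    linear_combination (h + v) * hPS

end Face

/-! ### Affine symmetry in terms of the shape parameters. -/

section AffineSymmetry

variable {d : ℕ}

local notation "E" => EuclideanSpace ℝ (Fin d)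

/-- A point of `S` at which a linear functional takes a strict maximum over `S` belongs to every
set with the same convex hull. -/
theorem mem_of_convexHull_eq_of_forall_lt {V : Type*} [AddCommGroup V] [Module ℝ V]
    {S T : Set V} {p : V} (hp : p ∈ S) (g : V →ₗ[ℝ] ℝ) (hg : ∀ q ∈ S, q ≠ p → g q < g p)
    (h : convexHull ℝ S = convexHull ℝ T) : p ∈ T := by
  have hc : Convex ℝ ({p} ∪ {q | g q < g p}) := by
    intro x hx y hy a b ha hb hab
    rcases eq_or_lt_of_le ha with rfl | ha
    · obtain rfl : b = 1 := by linarith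
      simpa using hy
    rcases eq_or_lt_of_le hb with rfl | hb
    · obtain rfl : a = 1 := by linarith
      simpa using hx
    rcases hx with rfl | hx
    · rcases hy with rfl | hy
      · left
        rw [← add_smul, hab, one_smul]; rfl
      · right
        have e : a * g x + b * g x = g x := by rw [← add_mul, hab, one_mul]
        have := mul_lt_mul_of_pos_left (show g y < g x from hy) hb
        change g (a • x + b • y) < g x
        rw [map_add, map_smul, map_smul, smul_eq_mul, smul_eq_mul]
        linarith
    · right
      have hy' : g y ≤ g p := by
        rcases hy with rfl | hy
        · exact le_rfl
        · exact le_of_lt hy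
      have e : a * g p + b * g p = g p := by rw [← add_mul, hab, one_mul]
      have h₁ := mul_lt_mul_of_pos_left (show g x < g p from hx) ha
      have h₂ := mul_le_mul_of_nonneg_left hy' hb.le
      change g (a • x + b • y) < g p
      rw [map_add, map_smul, map_smul, smul_eq_mul, smul_eq_mul]
      linarith
  have hsub : convexHull ℝ S ⊆ {p} ∪ {q | g q < g p} := by
    refine convexHull_min (fun q hq => ?_) hc
    by_cases hqp : q = p
    · exact Or.inl hqp
    · exact Or.inr (hg q hq hqp)
  by_contra hpT
  have hT : T ⊆ {q | g q < g p} := by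
    intro t ht
    rcases hsub (h ▸ subset_convexHull ℝ T ht) with rfl | hlt
    · exact absurd ht hpT
    · exact hlt
  have hlt : convexHull ℝ T ⊆ {q | g q < g p} :=
    convexHull_min hT (convex_halfSpace_lt g.isLinear _)
  exact lt_irrefl (g p) (hlt (h ▸ subset_convexHull ℝ S hp))

theorem LinearIndependent.exists_linearMap_pair {V W : Type*} [AddCommGroup V] [Module ℝ V]
    [AddCommGroup W] [Module ℝ W] {x y : V} (h : LinearIndependent ℝ ![x, y]) (a b : W) :
    ∃ T : V →ₗ[ℝ] W, T x = a ∧ T y = b := by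
  have hT := fun i => (Module.Basis.sumExtend h).constr_basis ℝ (Sum.elim ![a, b] 0) (Sum.inl i)
  have he : ∀ i, Module.Basis.sumExtend h (Sum.inl i) = ![x, y] i := by
    intro i; simp [Module.Basis.sumExtend]; rfl
  simp only [he, Sum.elim_inl] at hT
  exact ⟨_, by simpa using hT 0, by simpa using hT 1⟩

theorem HasQuadShape.left_mem_of_convexHull_eq {A B C D : E} {h v : ℝ}
    (H : HasQuadShape A B C D h v) {T : Set E}
    (hT : convexHull ℝ {A, B, C, D} = convexHull ℝ T) : A ∈ T := by
  obtain ⟨hh, hv, Q, x, y, hli, rfl, rfl, rfl, rfl⟩ := H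
  -- The coordinate along `x` attains its strict maximum over the four vertices at `A`.
  obtain ⟨g, hx, hy⟩ := hli.exists_linearMap_pair (1 : ℝ) 0
  refine mem_of_convexHull_eq_of_forall_lt (by simp) g ?_ hT
  have : 0 < h * v := by positivity
  rintro q (rfl | rfl | rfl | rfl) hq
  · exact absurd rfl hq
  · simp [hx, hy]
  · simp [hx]; linarith
  · simp [hx, hy]

theorem HasQuadShape.subset_of_convexHull_eq {A B C D : E} {h v : ℝ}
    (H : HasQuadShape A B C D h v) {T : Set E}
    (hT : convexHull ℝ {A, B, C, D} = convexHull ℝ T) : C ∈ T ∧ D ∈ T := by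
  refine ⟨H.rotate.rotate.left_mem_of_convexHull_eq ?_,
    H.rotate.rotate.rotate.left_mem_of_convexHull_eq ?_⟩ <;> rw [← hT] <;> congr 1 <;> ext p <;>
    simp only [Set.mem_insert_iff, Set.mem_singleton_iff] <;> tauto

/-- Vertices are recovered from the region, so `f` maps vertices onto vertices. It fixes `A` and
`B`, hence can only match or swap the other two; a swap contradicts the sign of the diagonal ratios.
-/
theorem HasQuadShape.areAffineSymmetric_iff {A B C D C' D' : E} {h v h' v' : ℝ}
    (H : HasQuadShape A B C D h v) (H' : HasQuadShape A B C' D' h' v') :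
    AreAffineSymmetric A B C D C' D' ↔ h = h' ∧ v = v' := by
  have H₂ := H'
  obtain ⟨hh, hv, Q, x, y, hli, rfl, rfl, rfl, rfl⟩ := H
  obtain ⟨hh', hv', Q', x', y', hli', hA, hB, rfl, rfl⟩ := H'
  unfold AreAffineSymmetric quadRegion
  constructor
  · rintro ⟨f, hf, hfix⟩
    have hfA := hfix _ (left_mem_segment ℝ _ _)
    have hfB := hfix _ (right_mem_segment ℝ _ _)
    rw [AffineMap.image_convexHull] at hf
    obtain ⟨hC, hD⟩ := H₂.subset_of_convexHull_eq hf.symm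
    simp only [Set.image_insert_eq, Set.image_singleton, hfA, hfB, Set.mem_insert_iff,
      Set.mem_singleton_iff] at hC hD
    have hmap : ∀ u : E, f (Q + u) = f Q + f.linear u := by
      intro u
      rw [add_comm Q u, add_comm (f Q)]
      exact f.map_vadd Q u
    have hx : f.linear x = Q' + x' - f Q := by rw [← hA, ← hfA, hmap]; abel
    have hy : f.linear y = Q' + y' - f Q := by rw [← hB, ← hfB, hmap]; abel
    have hfC : f (Q - (h * v) • x) = f Q - (h * v) • (Q' + x' - f Q) := by
      rw [sub_eq_add_neg Q, hmap, map_neg, map_smul, hx, ← sub_eq_add_neg]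
    have hfD : f (Q - (h / v) • y) = f Q - (h / v) • (Q' + y' - f Q) := by
      rw [sub_eq_add_neg Q, hmap, map_neg, map_smul, hy, ← sub_eq_add_neg]
    rw [hfC, hfD, hA, hB] at hC hD
    obtain ⟨R, hR⟩ : ∃ R, f Q = Q' + R := ⟨f Q - Q', by abel⟩
    rw [hR] at hC hD
    obtain ⟨a, ha⟩ : ∃ a, h * v = a := ⟨_, rfl⟩
    obtain ⟨b, hb⟩ : ∃ b, h / v = b := ⟨_, rfl⟩
    obtain ⟨a', ha'⟩ : ∃ a', h' * v' = a' := ⟨_, rfl⟩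
    obtain ⟨b', hb'⟩ : ∃ b', h' / v' = b' := ⟨_, rfl⟩
    have pa : 0 < a := by rw [← ha]; positivity
    have pb : 0 < b := by rw [← hb]; positivity
    have pa' : 0 < a' := by rw [← ha']; positivity
    have pb' : 0 < b' := by rw [← hb']; positivity
    rw [ha, ha', hb] at hC
    rw [ha, hb', hb] at hD
    have key : ∀ p q r s : ℝ, p • x' + q • y' - (r • x' + s • y') = 0 → p = r ∧ q = s :=
      fun p q r s e => hli'.pair_coords_eq (sub_eq_zero.1 e)
    rcases hC with e | e | e | e
    · have := (key (-a') 0 1 0 (by rw [← sub_eq_zero] at e; rw [← e]; module)).1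
      linarith
    · have := (key (-a') 0 0 1 (by rw [← sub_eq_zero] at e; rw [← e]; module)).1
      linarith
    · rcases hD with e' | e' | e' | e'
      · have := (key 0 (-b') 1 0 (by rw [← sub_eq_zero] at e'; rw [← e']; module)).1
        linarith
      · have := (key 0 (-b') 0 1 (by rw [← sub_eq_zero] at e'; rw [← e']; module)).2
        linarith
      · have := (key (-a') 0 0 (-b') (by
          rw [← e', ← sub_eq_zero] at e; rw [← e]; module)).1
        linarith
      -- The equations say `(1 + a) • R = (a - a') • x'` and `(1 + b) • R = (b - b') • y'`;
      -- eliminating `R` forces both differences to vanish.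
      · have := key ((1 + b) * (a - a')) 0 0 ((1 + a) * (b - b')) (by
          rw [← sub_eq_zero] at e e'
          rw [show (0 : E) = (1 + b) • (0 : E) - (1 + a) • (0 : E) by simp]
          nth_rewrite 1 [← e]
          rw [← e']
          module)
        have h₁ : a = a' := by
          have := (mul_eq_zero.1 this.1).resolve_left (by positivity); linarith
        have h₂ : b = b' := by
          have := (mul_eq_zero.1 this.2.symm).resolve_left (by positivity); linarith
        have hsq : h = h' := by
          have : h ^ 2 = h' ^ 2 := by
            calc h ^ 2 = a * b := by rw [← ha, ← hb]; field_simp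
              _ = h' ^ 2 := by rw [h₁, h₂, ← ha', ← hb']; field_simp
          nlinarith
        refine ⟨hsq, ?_⟩
        subst hsq
        rw [← ha, ← ha'] at h₁
        exact mul_left_cancel₀ hh.ne' h₁
    · rcases hD with e' | e' | e' | e'
      · have := (key 0 (-b') 1 0 (by rw [← sub_eq_zero] at e'; rw [← e']; module)).1
        linarith
      · have := (key 0 (-b') 0 1 (by rw [← sub_eq_zero] at e'; rw [← e']; module)).2
        linarith
      -- The swapped case: eliminating `R` equates a negative and a positive coefficient of `x'`.
      · have := (key ((1 + a) * (-a')) ((1 + a) * b) ((1 + b) * a) (- ((1 + b) * b')) (by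
          rw [← sub_eq_zero] at e e'
          rw [show (0 : E) = (1 + a) • (0 : E) - (1 + b) • (0 : E) by simp]
          nth_rewrite 1 [← e]
          rw [← e']
          module)).1
        nlinarith
      · have := (key (-a') 0 0 (-b') (by
          rw [← e', ← sub_eq_zero] at e; rw [← e]; module)).1
        linarith
  · rintro ⟨rfl, rfl⟩
    obtain ⟨T, hTx, hTy⟩ := hli.exists_linearMap_pair x' y'
    let f : E →ᵃ[ℝ] E :=
      { toFun := fun p => Q' + T (p - Q)
        linear := T
        map_vadd' := fun p u => by simp only [vadd_eq_add, map_sub, map_add]; abel }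
    have hf : ∀ p, f p = Q' + T (p - Q) := fun _ => rfl
    have hfA : f (Q + x) = Q + x := by rw [hf, add_sub_cancel_left, hTx, hA]
    have hfB : f (Q + y) = Q + y := by rw [hf, add_sub_cancel_left, hTy, hB]
    refine ⟨f, ?_, ?_⟩
    · rw [AffineMap.image_convexHull]
      simp only [Set.image_insert_eq, Set.image_singleton, hfA, hfB]
      simp only [hf, sub_sub_cancel_left, map_neg, map_smul, hTx, hTy, ← sub_eq_add_neg]
    · rintro p ⟨a, b, -, -, hab, rfl⟩
      rw [Convex.combo_affine_apply hab, hfA, hfB]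

end AffineSymmetry

/-! ### Independence of square roots of polynomials. -/

section SquareRoots

open Polynomial

theorem Polynomial.eq_of_infinite_family {ι : Type*} [Infinite ι] {w : ι → ℝ}
    (hw : Function.Injective w) {p q : ℝ[X]} (h : ∀ i, p.eval (w i) = q.eval (w i)) : p = q :=
  eq_of_infinite_eval_eq p q (Set.infinite_of_injective_forall_mem hw h)

/-- A polynomial none of whose nonzero square multiples is a square, so that its square root is
not a rational function. -/
def HasIrrationalSqrt (G : ℝ[X]) : Prop := ∀ f g : ℝ[X], f ^ 2 * G = g ^ 2 → f = 0

/-- A simple root of `G` has odd multiplicity in `f ^ 2 * G` but even multiplicity in `g ^ 2`. -/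
theorem Polynomial.eq_zero_of_sq_mul_eq_sq {K : Type*} [Field K] [CharZero K] {f g G : K[X]}
    {w : K} (h₀ : G.IsRoot w) (h₁ : ¬ (derivative G).IsRoot w) (h : f ^ 2 * G = g ^ 2) :
    f = 0 := by
  by_contra hf
  have hG : G ≠ 0 := by
    rintro rfl
    simp at h₁
  have hne : f * f * G ≠ 0 := mul_ne_zero (mul_ne_zero hf hf) hG
  have hg : g * g ≠ 0 := by rw [← sq, ← h, sq]; exact hne
  have hm := congrArg (rootMultiplicity w) h
  rw [sq, sq, rootMultiplicity_mul hne, rootMultiplicity_mul (mul_ne_zero hf hf),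
    rootMultiplicity_mul hg] at hm
  have h1 : 0 < rootMultiplicity w G := (rootMultiplicity_pos hG).2 h₀
  have h2 : ¬ 1 < rootMultiplicity w G := by
    rw [one_lt_rootMultiplicity_iff_isRoot hG]
    exact fun h => h₁ h.2
  omega

theorem hasIrrationalSqrt_of_simple_root {G : ℝ[X]} {w : ℂ} (h₀ : aeval w G = 0)
    (h₁ : aeval w (derivative G) ≠ 0) : HasIrrationalSqrt G := by
  intro f g h
  have e := congrArg (Polynomial.map (algebraMap ℝ ℂ)) h
  rw [Polynomial.map_mul, Polynomial.map_pow, Polynomial.map_pow] at e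
  refine (Polynomial.map_eq_zero_iff (algebraMap ℝ ℂ).injective).1
    (Polynomial.eq_zero_of_sq_mul_eq_sq (w := w) ?_ ?_ e)
  · rwa [IsRoot, eval_map_algebraMap]
  · rwa [IsRoot, derivative_map, eval_map_algebraMap]

theorem hasIrrationalSqrt_of_disc_ne_zero {a b c : ℝ} (h : b ^ 2 - 4 * a * c ≠ 0) :
    HasIrrationalSqrt (C a * X ^ 2 + C b * X + C c) := by
  have hdeg : (C a * X ^ 2 + C b * X + C c).degree ≠ 0 := by
    intro h0
    have e := eq_C_of_degree_eq_zero h0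
    have h1 := congrArg (fun p => coeff p 1) e
    have h2 := congrArg (fun p => coeff p 2) e
    simp [coeff_X, coeff_C] at h1 h2
    simp [h1, h2] at h
  obtain ⟨w, hw⟩ := IsAlgClosed.exists_aeval_eq_zero ℂ _ hdeg
  refine hasIrrationalSqrt_of_simple_root hw fun h' => h ?_
  simp at hw h'
  have : ((b ^ 2 - 4 * a * c : ℝ) : ℂ) = 0 := by
    push_cast
    linear_combination (2 * a * w + b) * h' - 4 * a * hw
  exact_mod_cast this

/-- The first factor has two distinct complex roots. If the second vanished at both, the two would
be proportional, against `hne`; so some root is simple for the product. -/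
theorem hasIrrationalSqrt_mul {a b c a' b' c' : ℝ} (ha : a ≠ 0) (h : b ^ 2 - 4 * a * c ≠ 0)
    (hne : a * c' ≠ a' * c) :
    HasIrrationalSqrt ((C a * X ^ 2 + C b * X + C c) * (C a' * X ^ 2 + C b' * X + C c')) := by
  have hdeg : (C a * X ^ 2 + C b * X + C c).degree ≠ 0 := by
    rw [degree_quadratic ha]; norm_num
  obtain ⟨w, hw⟩ := IsAlgClosed.exists_aeval_eq_zero ℂ _ hdeg
  have haC : (a : ℂ) ≠ 0 := by exact_mod_cast ha
  have hdC : (b ^ 2 - 4 * a * c : ℂ) ≠ 0 := by exact_mod_cast h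
  have hneC : (a * c' - a' * c : ℂ) ≠ 0 := by
    rw [sub_ne_zero]; exact_mod_cast hne
  simp at hw
  have main : ∀ u : ℂ, a * u ^ 2 + b * u + c = 0 → a' * u ^ 2 + b' * u + c' ≠ 0 →
      HasIrrationalSqrt ((C a * X ^ 2 + C b * X + C c) * (C a' * X ^ 2 + C b' * X + C c')) := by
    intro u h0 h1
    have h2 : 2 * a * u + b ≠ 0 := by
      intro h2
      apply hdC
      linear_combination (2 * a * u + b) * h2 - 4 * a * h0
    refine hasIrrationalSqrt_of_simple_root (w := u) (by simp [h0]) ?_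
    have : aeval u (derivative ((C a * X ^ 2 + C b * X + C c) * (C a' * X ^ 2 + C b' * X + C c')))
        = (2 * a * u + b) * (a' * u ^ 2 + b' * u + c') := by
      rw [derivative_mul, map_add, map_mul, map_mul]
      have e0 : aeval u (C a * X ^ 2 + C b * X + C c) = 0 := by simpa using h0
      rw [e0, zero_mul, add_zero]
      simp
      left
      ring
    rw [this]
    exact mul_ne_zero h2 h1
  by_cases h1 : a' * w ^ 2 + b' * w + c' = 0
  swap
  · exact main w hw h1
  have hw' : a * (-b / a - w) ^ 2 + b * (-b / a - w) + c = 0 := by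
    field_simp; linear_combination a * hw
  refine main (-b / a - w) hw' fun h2 => ?_
  -- Cancelling the quadratic terms leaves a linear polynomial with two distinct roots `w` and `-b /
  -- a - w`.
  have l₁ : (a * b' - a' * b) * w + (a * c' - a' * c) = 0 := by
    linear_combination a * h1 - a' * hw
  have l₂ : (a * b' - a' * b) * (-b / a - w) + (a * c' - a' * c) = 0 := by
    linear_combination a * h2 - a' * hw'
  have h3 : 2 * a * w + b ≠ 0 := by
    intro h2
    apply hdC
    linear_combination (2 * a * w + b) * h2 - 4 * a * hw
  have h4 : (a * b' - a' * b : ℂ) * (2 * a * w + b) = 0 := by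
    have : (a * b' - a' * b : ℂ) * (2 * a * w + b) = a * ((a * b' - a' * b) * w -
      (a * b' - a' * b) * (-b / a - w)) := by field_simp; ring
    rw [this]
    linear_combination a * (l₁ - l₂)
  rw [(mul_eq_zero.1 h4).resolve_right h3, zero_mul, zero_add] at l₁
  exact hneC l₁

variable {ι : Type*} [Infinite ι] {w U V : ι → ℝ}

theorem HasIrrationalSqrt.eq_zero_of_add_mul {G : ℝ[X]} (hG : HasIrrationalSqrt G)
    (hw : Function.Injective w) (hU : ∀ i, U i ^ 2 = G.eval (w i)) {P Q : ℝ[X]}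
    (h : ∀ i, P.eval (w i) + Q.eval (w i) * U i = 0) : P = 0 ∧ Q = 0 := by
  have e : Q ^ 2 * G = P ^ 2 := by
    refine Polynomial.eq_of_infinite_family hw fun i => ?_
    rw [eval_mul, eval_pow, eval_pow, ← hU]
    linear_combination (Q.eval (w i) * U i - P.eval (w i)) * h i
  have hQ := hG _ _ e
  refine ⟨?_, hQ⟩
  rw [hQ] at e
  exact pow_eq_zero_iff (two_ne_zero) |>.1 (by rw [← e]; ring)

/-- Field-theoretically, `1, U, V, U V` are independent over rational functions in `w` when none of
`G₁`, `G₂`, `G₁ * G₂` is a square up to squares. Multiplying by the conjugate under `V ↦ -V` leaves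
a relation in `U` alone, whose two coefficients vanish. -/
theorem not_biquadratic_relation {G₁ G₂ : ℝ[X]} (h₁ : HasIrrationalSqrt G₁)
    (h₂ : HasIrrationalSqrt G₂) (h₁₂ : HasIrrationalSqrt (G₁ * G₂))
    (hw : Function.Injective w) (hU : ∀ i, U i ^ 2 = G₁.eval (w i))
    (hV : ∀ i, V i ^ 2 = G₂.eval (w i)) {P Q R : ℝ[X]} {s : ℝ} (hs : s ≠ 0)
    (h : ∀ i, P.eval (w i) + Q.eval (w i) * U i + R.eval (w i) * V i + s * U i * V i = 0) :
    False := by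
  have hCs : (C s : ℝ[X]) ≠ 0 := C_ne_zero.2 hs
  obtain ⟨hX, hY⟩ := h₁.eq_zero_of_add_mul hw hU
    (P := P ^ 2 + Q ^ 2 * G₁ - G₂ * (R ^ 2 + C s ^ 2 * G₁)) (Q := 2 * (P * Q - G₂ * R * C s)) (by
      intro i
      simp only [eval_sub, eval_add, eval_mul, eval_pow, eval_C, eval_ofNat, ← hU, ← hV]
      linear_combination (P.eval (w i) + Q.eval (w i) * U i -
        (R.eval (w i) * V i + s * U i * V i)) * h i)
  have hY' : P * Q - G₂ * R * C s = 0 := (mul_eq_zero.1 hY).resolve_left two_ne_zero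
  -- Eliminating `Q` makes `G₂` or `G₁ * G₂` times a square equal to `P ^ 2`.
  have hprod : (P ^ 2 - R ^ 2 * G₂) * (P ^ 2 - C s ^ 2 * (G₁ * G₂)) = 0 := by
    linear_combination P ^ 2 * hX - G₁ * (P * Q + G₂ * R * C s) * hY'
  rcases mul_eq_zero.1 hprod with e | e
  · have hR := h₂ R P (by linear_combination -e)
    have hP : P = 0 := by
      rw [hR] at e
      exact pow_eq_zero_iff (two_ne_zero) |>.1 (by linear_combination e)
    have hG₁ : G₁ ≠ 0 := by
      rintro rfl
      exact one_ne_zero (h₁ 1 0 (by simp))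
    rw [hP, hR] at hX
    have : G₁ * (C s ^ 2 * G₂ - Q ^ 2) = 0 := by linear_combination -hX
    exact hCs (h₂ _ Q (sub_eq_zero.1 ((mul_eq_zero.1 this).resolve_left hG₁)))
  · exact hCs (h₁₂ _ P (by linear_combination -e))

end SquareRoots

/-! ### Impossible algebraic relations between linked faces. -/

section LinkedFaces

open Polynomial

/-- `P` and `S` are the hyperbolic cosine and sine of `log z`; in them every side factor is linear.
-/
theorem exists_hyperbolic_coords {z : ℝ} (hz : 0 < z) :
    ∃ P S, P ^ 2 - S ^ 2 = 1 ∧ P + S = z ∧ ∀ c, sideScale c z = P + c * S := by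
  refine ⟨(z + z⁻¹) / 2, (z - z⁻¹) / 2, by field_simp; ring, by ring, fun c => ?_⟩
  unfold sideScale
  rw [div_eq_mul_inv _ z]
  ring

/-- This symmetry exchanges the roles of the two directions of the net. -/
theorem sideScale_inv {c z : ℝ} : sideScale c z⁻¹ = sideScale (-c) z := by
  unfold sideScale
  rw [div_inv_eq_mul, div_eq_mul_inv _ z]
  ring

theorem mul_sideScale {c z : ℝ} (hz : 0 < z) :
    z * sideScale c z = (1 + c) / 2 * z ^ 2 + (1 - c) / 2 := by
  unfold sideScale; field_simp

theorem mul_self_injective {ι : Type*} {z : ι → ℝ} (hz : ∀ i, 0 < z i)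
    (hinj : Function.Injective z) : Function.Injective fun i => z i ^ 2 := by
  intro i j h
  exact hinj ((pow_left_inj₀ (hz i).le (hz j).le two_ne_zero).1 h)

variable {ι : Type*} [Infinite ι] {z : ι → ℝ}

/-- If neither the first nor the second side of a face matches, and both neighbouring scales are
irrational, the scales at the two remaining edges are independent. -/
theorem not_linked_of_irrational (hz : ∀ i, 0 < z i) (hinj : Function.Injective z)
    {c₁ c₂ c₁' c₂' : ℝ} (p₁ : 0 < c₁) (p₂ : 0 < c₂) (p₁' : 0 < c₁') (p₂' : 0 < c₂')
    (n₁ : c₁ ≠ c₁') (n₂ : c₂ ≠ c₂') (m₁ : c₁' ≠ 1) (m₂ : c₂' ≠ 1) {A B a₃ a₄ : ι → ℝ}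
    (hA : ∀ i, A i ^ 2 = sideScale c₁ (z i) ^ 2 - 1 + c₁' ^ 2)
    (hB : ∀ i, B i ^ 2 = sideScale (-c₂) (z i) ^ 2 - 1 + c₂' ^ 2)
    {e f g k κ₁ κ₂ κ₃ κ₄ : ℝ} (he : e ≠ 0) (hg : g ≠ 0) (hκ : κ₂ ≠ 0)
    (h₃ : ∀ i, a₃ i = e * B i + f * sideScale (-c₂) (z i))
    (h₄ : ∀ i, a₄ i = g * A i + k * sideScale c₁ (z i))
    (h : ∀ i, κ₁ * a₃ i ^ 2 + κ₂ * a₃ i * a₄ i + κ₃ * a₄ i ^ 2 = κ₄) : False := by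
  have hsq : ∀ {c c' : ℝ}, 0 < c → 0 < c' → c ≠ c' → c ^ 2 ≠ c' ^ 2 := fun h h' hne he =>
    hne ((pow_left_inj₀ h.le h'.le two_ne_zero).1 he)
  have q₁ : 1 - c₁' ^ 2 ≠ 0 := by
    have := hsq p₁' one_pos m₁
    intro h; apply this; linarith
  have q₂ : 1 - c₂' ^ 2 ≠ 0 := by
    have := hsq p₂' one_pos m₂
    intro h; apply this; linarith
  have q₃ : c₁ ^ 2 - c₁' ^ 2 ≠ 0 := sub_ne_zero.2 (hsq p₁ p₁' n₁)
  have q₄ : c₂ ^ 2 - c₂' ^ 2 ≠ 0 := sub_ne_zero.2 (hsq p₂ p₂' n₂)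
  set α₁ : ℝ[X] := C ((1 + c₁) / 2) * X + C ((1 - c₁) / 2) with hα₁
  set α₂ : ℝ[X] := C ((1 - c₂) / 2) * X + C ((1 + c₂) / 2) with hα₂
  have e₁ : ∀ i, α₁.eval (z i ^ 2) = z i * sideScale c₁ (z i) := by
    intro i; rw [mul_sideScale (hz i)]; simp [hα₁]
  have e₂ : ∀ i, α₂.eval (z i ^ 2) = z i * sideScale (-c₂) (z i) := by
    intro i; rw [mul_sideScale (hz i), sub_neg_eq_add, ← sub_eq_add_neg]; simp [hα₂]
  -- `G₁` and `G₂` are `(z A) ^ 2` and `(z B) ^ 2` as polynomials in `z ^ 2`.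
  set G₁ : ℝ[X] := C (((1 + c₁) / 2) ^ 2) * X ^ 2 +
    C ((1 + c₁) / 2 * (1 - c₁) - (1 - c₁' ^ 2)) * X + C (((1 - c₁) / 2) ^ 2) with hG₁
  set G₂ : ℝ[X] := C (((1 - c₂) / 2) ^ 2) * X ^ 2 +
    C ((1 + c₂) / 2 * (1 - c₂) - (1 - c₂' ^ 2)) * X + C (((1 + c₂) / 2) ^ 2) with hG₂
  have g₁ : G₁ = α₁ ^ 2 - C (1 - c₁' ^ 2) * X := by
    apply Polynomial.funext; intro x
    simp [hG₁, hα₁]; ring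
  have g₂ : G₂ = α₂ ^ 2 - C (1 - c₂' ^ 2) * X := by
    apply Polynomial.funext; intro x
    simp [hG₂, hα₂]; ring
  have hd₁ : ((1 + c₁) / 2 * (1 - c₁) - (1 - c₁' ^ 2)) ^ 2 -
      4 * ((1 + c₁) / 2) ^ 2 * ((1 - c₁) / 2) ^ 2 ≠ 0 := by
    rw [show ((1 + c₁) / 2 * (1 - c₁) - (1 - c₁' ^ 2)) ^ 2 -
      4 * ((1 + c₁) / 2) ^ 2 * ((1 - c₁) / 2) ^ 2 = (1 - c₁' ^ 2) * (c₁ ^ 2 - c₁' ^ 2) by ring]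
    exact mul_ne_zero q₁ q₃
  have hd₂ : ((1 + c₂) / 2 * (1 - c₂) - (1 - c₂' ^ 2)) ^ 2 -
      4 * ((1 - c₂) / 2) ^ 2 * ((1 + c₂) / 2) ^ 2 ≠ 0 := by
    rw [show ((1 + c₂) / 2 * (1 - c₂) - (1 - c₂' ^ 2)) ^ 2 -
      4 * ((1 - c₂) / 2) ^ 2 * ((1 + c₂) / 2) ^ 2 = (1 - c₂' ^ 2) * (c₂ ^ 2 - c₂' ^ 2) by ring]
    exact mul_ne_zero q₂ q₄
  have s₁ : HasIrrationalSqrt G₁ := hasIrrationalSqrt_of_disc_ne_zero hd₁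
  have s₂ : HasIrrationalSqrt G₂ := hasIrrationalSqrt_of_disc_ne_zero hd₂
  have s₁₂ : HasIrrationalSqrt (G₁ * G₂) := by
    -- The product of the roots is less than 1 for `G₁` and greater than 1 for `G₂`;
    -- cross-multiplying also covers `c₂ = 1`, where `G₂` drops degree.
    refine hasIrrationalSqrt_mul (by positivity) hd₁ (ne_of_gt ?_)
    have t₁ : (1 - c₁) ^ 2 < (1 + c₁) ^ 2 := by nlinarith
    have t₂ : (1 - c₂) ^ 2 < (1 + c₂) ^ 2 := by nlinarith
    have := mul_lt_mul'' t₁ t₂ (sq_nonneg _) (sq_nonneg _)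
    nlinarith
  refine not_biquadratic_relation s₁ s₂ s₁₂ (mul_self_injective hz hinj)
    (U := fun i => z i * A i) (V := fun i => z i * B i) ?_ ?_
    (P := C κ₁ * (C (e ^ 2) * G₂ + C (f ^ 2) * α₂ ^ 2) + C (κ₂ * f * k) * α₁ * α₂ +
      C κ₃ * (C (g ^ 2) * G₁ + C (k ^ 2) * α₁ ^ 2) - C κ₄ * X)
    (Q := C (κ₂ * g * f) * α₂ + C (2 * κ₃ * g * k) * α₁)
    (R := C (2 * κ₁ * e * f) * α₂ + C (κ₂ * e * k) * α₁)
    (s := κ₂ * e * g) (mul_ne_zero (mul_ne_zero hκ he) hg) ?_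
  · intro i
    simp only [g₁, eval_sub, eval_pow, e₁, eval_mul, eval_C, eval_X]
    rw [mul_pow, hA]; ring
  · intro i
    simp only [g₂, eval_sub, eval_pow, e₂, eval_mul, eval_C, eval_X]
    rw [mul_pow, hB]; ring
  · intro i
    simp only [g₁, g₂, eval_sub, eval_add, eval_pow, e₁, e₂, eval_mul, eval_C, eval_X]
    have h' := h i
    rw [h₃, h₄] at h'
    linear_combination (z i ^ 2) * h' - κ₁ * e ^ 2 * z i ^ 2 * hB i - κ₃ * g ^ 2 * z i ^ 2 * hA i

/-- Here `a₄` is rational and only `B` carries a root. After clearing denominators the coefficient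
of that root must vanish, which fails at the zero of `α₁`. -/
theorem not_linked_of_rational_left (hz : ∀ i, 0 < z i) (hinj : Function.Injective z)
    {c₁ c₂ c₂' c₄ : ℝ} (p₁ : 0 < c₁) (p₄ : 0 < c₄) (n₁ : c₁ ≠ 1)
    (q₂ : 1 - c₂' ^ 2 ≠ 0) (q₄ : c₂ ^ 2 - c₂' ^ 2 ≠ 0) {B a₃ a₄ : ι → ℝ}
    (hB : ∀ i, B i ^ 2 = sideScale (-c₂) (z i) ^ 2 - 1 + c₂' ^ 2)
    {e f κ₁ κ₂ κ₃ κ₄ : ℝ} (he : e ≠ 0) (hκ : κ₂ ≠ 0)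
    (h₃ : ∀ i, a₃ i = e * B i + f * sideScale (-c₂) (z i))
    (h₄ : ∀ i, sideScale c₁ (z i) * a₄ i = ((1 - c₄) * sideScale c₁ (z i) ^ 2 + (1 + c₄)) / 2)
    (h : ∀ i, κ₁ * a₃ i ^ 2 + κ₂ * a₃ i * a₄ i + κ₃ * a₄ i ^ 2 = κ₄) : False := by
  set α₁ : ℝ[X] := C ((1 + c₁) / 2) * X + C ((1 - c₁) / 2) with hα₁
  set α₂ : ℝ[X] := C ((1 - c₂) / 2) * X + C ((1 + c₂) / 2) with hα₂
  set M : ℝ[X] := C ((1 - c₄) / 2) * α₁ ^ 2 + C ((1 + c₄) / 2) * X with hM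
  have e₁ : ∀ i, α₁.eval (z i ^ 2) = z i * sideScale c₁ (z i) := by
    intro i; rw [mul_sideScale (hz i)]; simp [hα₁]
  have e₂ : ∀ i, α₂.eval (z i ^ 2) = z i * sideScale (-c₂) (z i) := by
    intro i; rw [mul_sideScale (hz i), sub_neg_eq_add, ← sub_eq_add_neg]; simp [hα₂]
  have e₃ : ∀ i, M.eval (z i ^ 2) = z i ^ 2 * (sideScale c₁ (z i) * a₄ i) := by
    intro i; rw [h₄]; simp only [hM, eval_add, eval_mul, eval_C, eval_pow, eval_X, e₁]; ring
  set G₂ : ℝ[X] := C (((1 - c₂) / 2) ^ 2) * X ^ 2 +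
    C ((1 + c₂) / 2 * (1 - c₂) - (1 - c₂' ^ 2)) * X + C (((1 + c₂) / 2) ^ 2) with hG₂
  have g₂ : G₂ = α₂ ^ 2 - C (1 - c₂' ^ 2) * X := by
    apply Polynomial.funext; intro x
    simp [hG₂, hα₂]; ring
  have hd₂ : ((1 + c₂) / 2 * (1 - c₂) - (1 - c₂' ^ 2)) ^ 2 -
      4 * ((1 - c₂) / 2) ^ 2 * ((1 + c₂) / 2) ^ 2 ≠ 0 := by
    rw [show ((1 + c₂) / 2 * (1 - c₂) - (1 - c₂' ^ 2)) ^ 2 -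
      4 * ((1 - c₂) / 2) ^ 2 * ((1 + c₂) / 2) ^ 2 = (1 - c₂' ^ 2) * (c₂ ^ 2 - c₂' ^ 2) by ring]
    exact mul_ne_zero q₂ q₄
  have s₂ : HasIrrationalSqrt G₂ := hasIrrationalSqrt_of_disc_ne_zero hd₂
  obtain ⟨-, hY⟩ := s₂.eq_zero_of_add_mul (mul_self_injective hz hinj)
    (U := fun i => z i * B i)
    (P := C κ₁ * (C (e ^ 2) * G₂ + C (f ^ 2) * α₂ ^ 2) * α₁ ^ 2 + C (κ₂ * f) * α₂ * α₁ * M +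
      C κ₃ * M ^ 2 - C κ₄ * α₁ ^ 2 * X)
    (Q := α₁ * (C e * (C (2 * κ₁ * f) * (α₂ * α₁) + C κ₂ * M)))
    (by
      intro i
      simp only [g₂, eval_sub, eval_pow, e₂, eval_mul, eval_C, eval_X]
      rw [mul_pow, hB]; ring)
    (by
      intro i
      simp only [g₂, eval_sub, eval_add, eval_pow, e₁, e₂, e₃, eval_mul, eval_C, eval_X]
      have h' := h i
      rw [h₃] at h'
      linear_combination (z i ^ 4 * sideScale c₁ (z i) ^ 2) * h' -
        κ₁ * e ^ 2 * z i ^ 4 * sideScale c₁ (z i) ^ 2 * hB i)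
  have hc : 1 + c₁ ≠ 0 := by positivity
  have hα₁0 : α₁ ≠ 0 := by
    intro h0
    have := congrArg (fun p => coeff p 1) h0
    simp [hα₁, coeff_C] at this
    exact hc this
  have hY' : C (2 * κ₁ * f) * (α₂ * α₁) + C κ₂ * M = 0 :=
    (mul_eq_zero.1 ((mul_eq_zero.1 hY).resolve_left hα₁0)).resolve_left (C_ne_zero.2 he)
  -- At this point only the term with `M` survives, and it is nonzero since `c₁ ≠ 1` keeps the point
  -- away from 0.
  have hr : α₁.eval (-(1 - c₁) / (1 + c₁)) = 0 := by
    simp [hα₁]; field_simp; ring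
  have := congrArg (eval (-(1 - c₁) / (1 + c₁))) hY'
  simp only [hM, eval_add, eval_mul, eval_C, eval_pow, eval_X, eval_zero, hr] at this
  have hne : κ₂ * ((1 + c₄) / 2 * (-(1 - c₁) / (1 + c₁))) ≠ 0 :=
    mul_ne_zero hκ (mul_ne_zero (by positivity)
      (div_ne_zero (neg_ne_zero.2 (sub_ne_zero.2 n₁.symm)) hc))
  exact hne (by linear_combination this)

/-- Both factors are rational, so the relation is a polynomial identity. The zeros of `α₁` and `α₂`
kill `κ₃` and `κ₁`; evaluating what remains there and at 0 is contradictory. -/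
theorem not_linked_of_rational (hz : ∀ i, 0 < z i) (hinj : Function.Injective z)
    {c₁ c₂ c₃ c₄ : ℝ} (p₁ : 0 < c₁) (p₂ : 0 < c₂) (p₃ : 0 < c₃) (p₄ : 0 < c₄)
    (n₁ : c₁ ≠ 1) (n₂ : c₂ ≠ 1) {a₃ a₄ : ι → ℝ} {κ₁ κ₂ κ₃ κ₄ : ℝ} (hκ : κ₂ ≠ 0)
    (h₃ : ∀ i, sideScale (-c₂) (z i) * a₃ i =
      ((1 - c₃) * sideScale (-c₂) (z i) ^ 2 + (1 + c₃)) / 2)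
    (h₄ : ∀ i, sideScale c₁ (z i) * a₄ i = ((1 - c₄) * sideScale c₁ (z i) ^ 2 + (1 + c₄)) / 2)
    (h : ∀ i, κ₁ * a₃ i ^ 2 + κ₂ * a₃ i * a₄ i + κ₃ * a₄ i ^ 2 = κ₄) : False := by
  set α₁ : ℝ[X] := C ((1 + c₁) / 2) * X + C ((1 - c₁) / 2) with hα₁
  set α₂ : ℝ[X] := C ((1 - c₂) / 2) * X + C ((1 + c₂) / 2) with hα₂
  set M : ℝ[X] := C ((1 - c₄) / 2) * α₁ ^ 2 + C ((1 + c₄) / 2) * X with hM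
  set M' : ℝ[X] := C ((1 - c₃) / 2) * α₂ ^ 2 + C ((1 + c₃) / 2) * X with hM'
  have e₁ : ∀ i, α₁.eval (z i ^ 2) = z i * sideScale c₁ (z i) := by
    intro i; rw [mul_sideScale (hz i)]; simp [hα₁]
  have e₂ : ∀ i, α₂.eval (z i ^ 2) = z i * sideScale (-c₂) (z i) := by
    intro i; rw [mul_sideScale (hz i), sub_neg_eq_add, ← sub_eq_add_neg]; simp [hα₂]
  have e₃ : ∀ i, M.eval (z i ^ 2) = z i ^ 2 * (sideScale c₁ (z i) * a₄ i) := by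
    intro i; rw [h₄]; simp only [hM, eval_add, eval_mul, eval_C, eval_pow, eval_X, e₁]; ring
  have e₄ : ∀ i, M'.eval (z i ^ 2) = z i ^ 2 * (sideScale (-c₂) (z i) * a₃ i) := by
    intro i; rw [h₃]; simp only [hM', eval_add, eval_mul, eval_C, eval_pow, eval_X, e₂]; ring
  have hpoly : C κ₁ * M' ^ 2 * α₁ ^ 2 + C κ₂ * M * M' * α₁ * α₂ + C κ₃ * M ^ 2 * α₂ ^ 2 =
      C κ₄ * X * α₁ ^ 2 * α₂ ^ 2 := by
    refine Polynomial.eq_of_infinite_family (mul_self_injective hz hinj) fun i => ?_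
    simp only [eval_add, eval_pow, e₁, e₂, e₃, e₄, eval_mul, eval_C, eval_X]
    linear_combination (z i ^ 6 * sideScale c₁ (z i) ^ 2 * sideScale (-c₂) (z i) ^ 2) * h i
  have hc₁ : 1 + c₁ ≠ 0 := by positivity
  have hc₁' : 1 - c₁ ≠ 0 := sub_ne_zero.2 n₁.symm
  have hc₂ : 1 - c₂ ≠ 0 := sub_ne_zero.2 n₂.symm
  have hc₂' : 1 + c₂ ≠ 0 := by positivity
  have hc₃ : 1 + c₃ ≠ 0 := by positivity
  have hc₄ : 1 + c₄ ≠ 0 := by positivity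
  obtain ⟨w₁, hw₁⟩ : ∃ w, w = -(1 - c₁) / (1 + c₁) := ⟨_, rfl⟩
  obtain ⟨w₂, hw₂⟩ : ∃ w, w = -(1 + c₂) / (1 - c₂) := ⟨_, rfl⟩
  have hw₁0 : w₁ ≠ 0 := by rw [hw₁]; exact div_ne_zero (neg_ne_zero.2 hc₁') hc₁
  have hw₂0 : w₂ ≠ 0 := by rw [hw₂]; exact div_ne_zero (neg_ne_zero.2 hc₂') hc₂
  have r₁ : α₁.eval w₁ = 0 := by simp [hα₁, hw₁]; field_simp; ring
  have r₂ : α₂.eval w₂ = 0 := by simp [hα₂, hw₂]; field_simp; ring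
  have r₁' : α₂.eval w₁ ≠ 0 := by
    have : α₂.eval w₁ = (c₁ + c₂) / (1 + c₁) := by simp [hα₂, hw₁]; field_simp; ring
    rw [this]; positivity
  have r₂' : α₁.eval w₂ ≠ 0 := by
    have : α₁.eval w₂ = -(c₁ + c₂) / (1 - c₂) := by simp [hα₁, hw₂]; field_simp; ring
    rw [this]
    exact div_ne_zero (neg_ne_zero.2 (by positivity)) hc₂
  have t₁ : M.eval w₁ ≠ 0 := by
    simp only [hM, eval_add, eval_mul, eval_C, eval_pow, eval_X, r₁]
    simp [hc₄, hw₁0]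
  have t₂ : M'.eval w₂ ≠ 0 := by
    simp only [hM', eval_add, eval_mul, eval_C, eval_pow, eval_X, r₂]
    simp [hc₃, hw₂0]
  have hκ₃ : κ₃ = 0 := by
    have := congrArg (eval w₁) hpoly
    simp only [eval_add, eval_mul, eval_C, eval_pow, eval_X, r₁] at this
    simpa [t₁, r₁'] using this
  have hκ₁ : κ₁ = 0 := by
    have := congrArg (eval w₂) hpoly
    simp only [eval_add, eval_mul, eval_C, eval_pow, eval_X, r₂] at this
    simpa [t₂, r₂'] using this
  have hα₁0 : α₁ ≠ 0 := by rintro h0; rw [h0] at r₂'; simp at r₂'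
  have hα₂0 : α₂ ≠ 0 := by rintro h0; rw [h0] at r₁'; simp at r₁'
  have hpoly' : C κ₂ * M * M' = C κ₄ * X * α₁ * α₂ := by
    apply mul_right_cancel₀ (mul_ne_zero hα₁0 hα₂0)
    rw [hκ₁, hκ₃, C_0] at hpoly
    linear_combination hpoly
  have u₁ : M'.eval w₁ = 0 := by
    have := congrArg (eval w₁) hpoly'
    simp only [eval_mul, eval_C, eval_X, r₁] at this
    simpa [hκ, t₁] using this
  have u₂ : M.eval w₂ = 0 := by
    have := congrArg (eval w₂) hpoly'
    simp only [eval_mul, eval_C, eval_X, r₂] at this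
    simpa [hκ, t₂] using this
  have u₃ : M.eval 0 * M'.eval 0 = 0 := by
    have := congrArg (eval 0) hpoly'
    simp only [eval_mul, eval_C, eval_X] at this
    simpa [hκ] using this
  -- A zero at 0 reduces `M` or `M'` to `X`, which cannot vanish at `w₂` or `w₁` respectively.
  rcases mul_eq_zero.1 u₃ with u | u
  · have : c₄ = 1 := by
      simp [hM, hα₁, hc₁'] at u; linarith
    simp [hM, this, hw₂0] at u₂
  · have : c₃ = 1 := by
      simp [hM', hα₂, hc₂'] at u; linarith
    simp [hM', this, hw₁0] at u₁

end LinkedFaces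

/-! ### Four faces around an inner vertex. -/

section VertexCondition

variable {ι : Type*} [Infinite ι]

/-- In an infinite family of deformations of four faces around a vertex, two consecutive edges
cannot both carry different shape parameters of their adjacent faces. -/
theorem eq_or_eq_of_linked {z₁₂ z₁₄ z₃₂ z₃₄ : ι → ℝ} (hz₁₂ : ∀ i, 0 < z₁₂ i)
    (hz₁₄ : ∀ i, 0 < z₁₄ i) (hz₃₂ : ∀ i, 0 < z₃₂ i) (hz₃₄ : ∀ i, 0 < z₃₄ i)
    (hinj : Function.Injective z₁₂) {c₁ c₂ c₃ c₄ c₁' c₂' c₃' c₄' : ℝ}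
    (p₁ : 0 < c₁) (p₂ : 0 < c₂) (p₃ : 0 < c₃) (p₄ : 0 < c₄)
    (p₁' : 0 < c₁') (p₂' : 0 < c₂') (p₃' : 0 < c₃') (p₄' : 0 < c₄')
    (h₁ : ∀ i, sideScale c₁ (z₁₂ i) = sideScale c₁' (z₁₄ i))
    (h₂ : ∀ i, sideScale (-c₂) (z₁₂ i) = sideScale (-c₂') (z₃₂ i))
    (h₃ : ∀ i, sideScale c₃ (z₃₂ i) = sideScale c₃' (z₃₄ i))
    (h₄ : ∀ i, sideScale (-c₄) (z₁₄ i) = sideScale (-c₄') (z₃₄ i)) :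
    c₁ = c₁' ∨ c₂ = c₂' := by
  by_contra! hne
  obtain ⟨n₁, n₂⟩ := hne
  have hsq : ∀ {c c' : ℝ}, 0 < c → 0 < c' → c ≠ c' → c ^ 2 ≠ c' ^ 2 := fun h h' hne he =>
    hne ((pow_left_inj₀ h.le h'.le two_ne_zero).1 he)
  choose P S hPS hz hL using fun i => exists_hyperbolic_coords (hz₁₄ i)
  choose P' S' hPS' hz' hL' using fun i => exists_hyperbolic_coords (hz₃₂ i)
  choose P'' S'' hPS'' hz'' hL'' using fun i => exists_hyperbolic_coords (hz₃₄ i)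
  -- Elimination of `z₃₄`: both factors are linear in `P''`, `S''`, so the hyperbola becomes a conic
  -- in them.
  have hrel : ∀ i, (c₄' ^ 2 - 1) * sideScale c₃ (z₃₂ i) ^ 2 +
      2 * (1 + c₃' * c₄') * sideScale c₃ (z₃₂ i) * sideScale (-c₄) (z₁₄ i) +
      (c₃' ^ 2 - 1) * sideScale (-c₄) (z₁₄ i) ^ 2 = (c₃' + c₄') ^ 2 := by
    intro i
    rw [h₃, h₄, hL'', hL'']
    linear_combination (c₃' + c₄') ^ 2 * hPS'' i
  have hκ : 2 * (1 + c₃' * c₄') ≠ 0 := by positivity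
  have hA : ∀ i, (c₁' * P i + S i) ^ 2 = sideScale c₁ (z₁₂ i) ^ 2 - 1 + c₁' ^ 2 := by
    intro i; rw [h₁, hL]; linear_combination (c₁' ^ 2 - 1) * hPS i
  have hB : ∀ i, (c₂' * P' i - S' i) ^ 2 = sideScale (-c₂) (z₁₂ i) ^ 2 - 1 + c₂' ^ 2 := by
    intro i; rw [h₂, hL']; linear_combination (c₂' ^ 2 - 1) * hPS' i
  have hrat₄ : c₁' = 1 → ∀ i, sideScale c₁ (z₁₂ i) * sideScale (-c₄) (z₁₄ i) =
      ((1 - c₄) * sideScale c₁ (z₁₂ i) ^ 2 + (1 + c₄)) / 2 := by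
    rintro rfl i
    rw [h₁, hL, hL]
    linear_combination (1 + c₄) / 2 * hPS i
  have hrat₃ : c₂' = 1 → ∀ i, sideScale (-c₂) (z₁₂ i) * sideScale c₃ (z₃₂ i) =
      ((1 - c₃) * sideScale (-c₂) (z₁₂ i) ^ 2 + (1 + c₃)) / 2 := by
    rintro rfl i
    rw [h₂, hL', hL']
    linear_combination (1 + c₃) / 2 * hPS' i
  -- For `c₁' ≠ 1`, the forms `c₁' P + S` and `P + c₁' S` are independent and express every other
  -- factor. For `c₁' = 1` the factor is `z₁₄` itself, hence the rational case.
  have hirr₄ : c₁' ≠ 1 → ∀ i, sideScale (-c₄) (z₁₄ i) =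
      (c₁' + c₄) / (c₁' ^ 2 - 1) * (c₁' * P i + S i) +
      -(1 + c₁' * c₄) / (c₁' ^ 2 - 1) * sideScale c₁ (z₁₂ i) := by
    intro hne i
    have : c₁' ^ 2 - 1 ≠ 0 := by
      have := hsq p₁' one_pos hne
      rw [one_pow] at this
      exact sub_ne_zero.2 this
    rw [h₁, hL, hL]
    field_simp
    ring
  have hirr₃ : c₂' ≠ 1 → ∀ i, sideScale c₃ (z₃₂ i) =
      (c₂' + c₃) / (c₂' ^ 2 - 1) * (c₂' * P' i - S' i) +
      -(1 + c₂' * c₃) / (c₂' ^ 2 - 1) * sideScale (-c₂) (z₁₂ i) := by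
    intro hne i
    have : c₂' ^ 2 - 1 ≠ 0 := by
      have := hsq p₂' one_pos hne
      rw [one_pow] at this
      exact sub_ne_zero.2 this
    rw [h₂, hL', hL']
    field_simp
    ring
  have hq : ∀ {c : ℝ}, 0 < c → c ≠ 1 → 1 - c ^ 2 ≠ 0 := by
    intro c hc hne h
    exact hsq hc one_pos hne (by linarith)
  have hquot : ∀ {c c' : ℝ}, 0 < c → 0 < c' → c ≠ 1 → (c + c') / (c ^ 2 - 1) ≠ 0 := by
    intro c c' hc hc' hne
    refine div_ne_zero (by positivity) fun h => hq hc hne (by linarith)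
  by_cases m₁ : c₁' = 1 <;> by_cases m₂ : c₂' = 1
  · exact not_linked_of_rational hz₁₂ hinj p₁ p₂ p₃ p₄ (m₁ ▸ n₁) (m₂ ▸ n₂) hκ (hrat₃ m₂)
      (hrat₄ m₁) hrel
  · exact not_linked_of_rational_left hz₁₂ hinj p₁ p₄ (m₁ ▸ n₁) (hq p₂' m₂)
      (sub_ne_zero.2 (hsq p₂ p₂' n₂)) hB (hquot p₂' p₃ m₂) hκ (hirr₃ m₂) (hrat₄ m₁) hrel
  -- Inverting `z₁₂` swaps the roles of the two edges.
  · refine not_linked_of_rational_left (z := fun i => (z₁₂ i)⁻¹) (fun i => inv_pos.2 (hz₁₂ i))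
      (inv_injective.comp hinj) p₂ p₃ (m₂ ▸ n₂) (hq p₁' m₁)
      (sub_ne_zero.2 (hsq p₁ p₁' n₁)) (B := fun i => c₁' * P i + S i) ?_ (hquot p₁' p₄ m₁) hκ
      (a₃ := fun i => sideScale (-c₄) (z₁₄ i)) (a₄ := fun i => sideScale c₃ (z₃₂ i))
      (f := -(1 + c₁' * c₄) / (c₁' ^ 2 - 1)) (κ₁ := c₃' ^ 2 - 1) (κ₃ := c₄' ^ 2 - 1)
      (κ₄ := (c₃' + c₄') ^ 2) ?_ ?_ ?_
    · simpa only [sideScale_inv, neg_neg] using hA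
    · simpa only [sideScale_inv, neg_neg] using hirr₄ m₁
    · simpa only [sideScale_inv] using hrat₃ m₂
    · intro i
      linear_combination hrel i
  · exact not_linked_of_irrational hz₁₂ hinj p₁ p₂ p₁' p₂' n₁ n₂ m₁ m₂ hA hB
      (hquot p₂' p₃ m₂) (hquot p₁' p₄ m₁) hκ (hirr₃ m₂) (hirr₄ m₁) hrel

/-- The derivative of `P + c S` in `log z` is `c (P + S / c)`, that is, `c` times the factor of the
opposite side. Positivity of the latter therefore selects a monotone branch; without it injectivity
can fail. -/
theorem sideScale_injOn {c z z' : ℝ} (hc : c ≠ 0) (hz : 0 < z) (hz' : 0 < z')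
    (h : sideScale c z = sideScale c z') (hp : 0 < sideScale (1 / c) z)
    (hp' : 0 < sideScale (1 / c) z') : z = z' := by
  obtain ⟨P, S, hPS, rfl, hL⟩ := exists_hyperbolic_coords hz
  obtain ⟨P', S', hPS', rfl, hL'⟩ := exists_hyperbolic_coords hz'
  rw [hL, hL'] at h
  rw [hL] at hp
  rw [hL'] at hp'
  have e : (P + 1 / c * S) ^ 2 = (P' + 1 / c * S') ^ 2 := by
    field_simp
    linear_combination (P + c * S + (P' + c * S')) * h + (c ^ 2 - 1) * hPS - (c ^ 2 - 1) * hPS'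
  have e' := (pow_left_inj₀ hp.le hp'.le two_ne_zero).1 e
  by_cases hc1 : c ^ 2 = 1
  · rcases eq_or_eq_neg_of_sq_eq_sq c 1 (by rw [hc1, one_pow]) with rfl | rfl
    · simpa using h
    · have hne : P - S ≠ 0 := by
        intro h0
        have : (P - S) * (P + S) = 1 := by linear_combination hPS
        rw [h0, zero_mul] at this
        exact zero_ne_one this
      apply mul_left_cancel₀ hne
      linear_combination hPS - hPS' - (P' + S') * h
  · have : c ^ 2 - 1 ≠ 0 := sub_ne_zero.2 hc1
    have hS : S = S' := by
      apply mul_left_cancel₀ this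
      field_simp at e'
      linear_combination c * h - e'
    subst hS
    linarith

/-- The two nontrivial alternatives for the deformations of four faces around a vertex. -/
theorem eq_or_eq_of_matching {z y : ι → ℝ} (hz : ∀ i, 0 < z i) (hy : ∀ i, 0 < y i)
    (zinj : Function.Injective z) (yinj : Function.Injective y) {c₂ c₄ c₂' c₄' : ℝ}
    (p₂ : 0 < c₂) (p₂' : 0 < c₂')
    (h₂ : ∀ i, sideScale (-c₂) (z i) = sideScale (-c₂') (y i))
    (h₄ : ∀ i, sideScale (-c₄) (z i) = sideScale (-c₄') (y i)) :
    (c₂ = c₂' ∧ c₄ = c₄') ∨ (c₂ = c₄ ∧ c₂' = c₄') := by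
  choose P S hPS hzP hL using fun i => exists_hyperbolic_coords (hz i)
  choose P' S' hPS' hyP hL' using fun i => exists_hyperbolic_coords (hy i)
  have e₂ : ∀ i, P i - c₂ * S i = P' i - c₂' * S' i := fun i => by
    have := h₂ i; rw [hL, hL'] at this; linear_combination this
  have e₄ : ∀ i, P i - c₄ * S i = P' i - c₄' * S' i := fun i => by
    have := h₄ i; rw [hL, hL'] at this; linear_combination this
  have hdiff : ∀ i, (c₄ - c₂) * S i = (c₄' - c₂') * S' i := fun i => by
    linear_combination e₂ i - e₄ i
  have hS : ∀ {w : ι → ℝ} {P S : ι → ℝ}, (∀ i, 0 < w i) → (∀ i, P i ^ 2 - S i ^ 2 = 1) →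
      (∀ i, P i + S i = w i) → ∀ i, S i = 0 → w i = 1 := by
    intro w P S hw h1 h2 i h0
    have h3 := h1 i
    have h4 := h2 i
    have h5 := hw i
    rw [h0] at h3 h4
    nlinarith
  by_cases hc : c₂ = c₄
  · right
    refine ⟨hc, ?_⟩
    obtain ⟨i, hi⟩ : ∃ i, y i ≠ 1 := by
      obtain ⟨i, j, hij⟩ := exists_pair_ne ι
      by_contra! hall
      exact hij (yinj ((hall i).trans (hall j).symm))
    have := hdiff i
    rw [hc, sub_self, zero_mul] at this
    have hne : S' i ≠ 0 := fun h0 => hi (hS hy hPS' hyP i h0)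
    linarith [(mul_eq_zero.1 this.symm).resolve_right hne]
  · left
    obtain ⟨f⟩ : Nonempty (ℕ ↪ ι) := ⟨Infinite.natEmbedding ι⟩
    have hne : ∀ i, z i ≠ 1 → S i ≠ 0 := fun i hi h0 => hi (hS hz hPS hzP i h0)
    -- By injectivity at most one index has `z = 1`, so among three at least two remain.
    obtain ⟨i, j, hij, hi, hj⟩ : ∃ i j, i ≠ j ∧ z i ≠ 1 ∧ z j ≠ 1 := by
      have h01 : f 0 ≠ f 1 := fun h => by simpa using f.injective h
      have h02 : f 0 ≠ f 2 := fun h => by simpa using f.injective h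
      have h12 : f 1 ≠ f 2 := fun h => by simpa using f.injective h
      by_cases h0 : z (f 0) = 1
      · exact ⟨f 1, f 2, h12, fun h => h01 (zinj (h0.trans h.symm)),
          fun h => h02 (zinj (h0.trans h.symm))⟩
      · by_cases h1 : z (f 1) = 1
        · exact ⟨f 0, f 2, h02, h0, fun h => h12 (zinj (h1.trans h.symm))⟩
        · exact ⟨f 0, f 1, h01, h0, h1⟩
    have hc' : c₄ - c₂ ≠ 0 := sub_ne_zero.2 (Ne.symm hc)
    have hd : c₄' - c₂' ≠ 0 := by
      intro h0
      have := hdiff i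
      rw [h0, zero_mul] at this
      exact (mul_ne_zero hc' (hne i hi)) this
    -- The hyperbolic coordinates are related by `S' = κ S`, `P' = P + μ S`. Preserving `P ^ 2 - S ^
    -- 2` at two non-proportional points forces `μ = 0` and `κ ^ 2 = 1`; positivity of `c₂`, `c₂'`
    -- gives `κ = 1`.
    obtain ⟨κ, hκ⟩ : ∃ κ, κ = (c₄ - c₂) / (c₄' - c₂') := ⟨_, rfl⟩
    have hS' : ∀ i, S' i = κ * S i := fun i => by
      rw [hκ]; field_simp; linear_combination -hdiff i
    have hP' : ∀ i, P' i = P i + (c₂' * κ - c₂) * S i := fun i => by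
      have := e₂ i; rw [hS'] at this; linear_combination -this
    have key : ∀ i, S i ≠ 0 →
        2 * (c₂' * κ - c₂) * P i + (1 + (c₂' * κ - c₂) ^ 2 - κ ^ 2) * S i = 0 := by
      intro i hi
      apply mul_left_cancel₀ hi
      have := hPS' i
      rw [hS', hP'] at this
      linear_combination this - hPS i
    have hκ₂ : c₂' * κ - c₂ = 0 := by
      have hdet : P i * S j - P j * S i ≠ 0 := by
        intro h0
        apply hij
        apply zinj
        rw [← hzP, ← hzP]
        have hPi : 0 < P i := by nlinarith [hz i, hzP i, hPS i]
        have hPj : 0 < P j := by nlinarith [hz j, hzP j, hPS j]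
        have h1 : P i ^ 2 = P j ^ 2 := by
          linear_combination -(P i * S j + P j * S i) * h0 + P j ^ 2 * hPS i - P i ^ 2 * hPS j
        have h2 := (pow_left_inj₀ hPi.le hPj.le two_ne_zero).1 h1
        rw [h2] at h0 ⊢
        have : P j * (S j - S i) = 0 := by linear_combination h0
        linarith [(mul_eq_zero.1 this).resolve_left hPj.ne']
      have h0 : (c₂' * κ - c₂) * (P i * S j - P j * S i) = 0 := by
        linear_combination (S j * key i (hne i hi) - S i * key j (hne j hj)) / 2
      exact (mul_eq_zero.1 h0).resolve_right hdet
    have hκ1 : κ ^ 2 = 1 := by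
      have := key i (hne i hi)
      rw [hκ₂] at this
      have h0 : (1 - κ ^ 2) * S i = 0 := by linear_combination this
      linarith [(mul_eq_zero.1 h0).resolve_right (hne i hi)]
    have hκpos : 0 < κ := by
      have : 0 < c₂' * κ := by linarith
      exact (mul_pos_iff_of_pos_left p₂').1 this
    have hκone : κ = 1 := by nlinarith
    rw [hκone] at hκ₂ hκ
    have : c₂ = c₂' := by linarith
    refine ⟨this, ?_⟩
    field_simp at hκ
    linarith

/-- The edges 1, 2, 3, 4 are in cyclic order. Starting `eq_or_eq_of_linked` from each face shows
that no two consecutive edges both mismatch, so two opposite edges match. Their faces then share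
parameters, and `eq_or_eq_of_matching` compares the other pair. -/
theorem vertex_trichotomy {z₁₂ z₁₄ z₃₂ z₃₄ : ι → ℝ} (hz₁₂ : ∀ i, 0 < z₁₂ i)
    (hz₁₄ : ∀ i, 0 < z₁₄ i) (hz₃₂ : ∀ i, 0 < z₃₂ i) (hz₃₄ : ∀ i, 0 < z₃₄ i)
    (j₁₂ : Function.Injective z₁₂) (j₁₄ : Function.Injective z₁₄)
    (j₃₂ : Function.Injective z₃₂) (j₃₄ : Function.Injective z₃₄)
    {c₁ c₂ c₃ c₄ c₁' c₂' c₃' c₄' : ℝ}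
    (p₁ : 0 < c₁) (p₂ : 0 < c₂) (p₃ : 0 < c₃) (p₄ : 0 < c₄)
    (p₁' : 0 < c₁') (p₂' : 0 < c₂') (p₃' : 0 < c₃') (p₄' : 0 < c₄')
    (h₁ : ∀ i, sideScale c₁ (z₁₂ i) = sideScale c₁' (z₁₄ i))
    (h₂ : ∀ i, sideScale (-c₂) (z₁₂ i) = sideScale (-c₂') (z₃₂ i))
    (h₃ : ∀ i, sideScale c₃ (z₃₂ i) = sideScale c₃' (z₃₄ i))
    (h₄ : ∀ i, sideScale (-c₄) (z₁₄ i) = sideScale (-c₄') (z₃₄ i))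
    (o₁ : ∀ i, 0 < sideScale (1 / c₁) (z₁₂ i)) (o₁' : ∀ i, 0 < sideScale (1 / c₁') (z₁₄ i))
    (o₂ : ∀ i, 0 < sideScale (-(1 / c₂)) (z₁₂ i))
    (o₂' : ∀ i, 0 < sideScale (-(1 / c₂')) (z₃₂ i))
    (o₃ : ∀ i, 0 < sideScale (1 / c₃) (z₃₂ i)) (o₃' : ∀ i, 0 < sideScale (1 / c₃') (z₃₄ i))
    (o₄ : ∀ i, 0 < sideScale (-(1 / c₄)) (z₁₄ i))
    (o₄' : ∀ i, 0 < sideScale (-(1 / c₄')) (z₃₄ i)) :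
    (c₁ = c₁' ∧ c₂ = c₂' ∧ c₃ = c₃' ∧ c₄ = c₄') ∨
      (c₁ = c₁' ∧ c₃ = c₃' ∧ c₂ = c₄ ∧ c₂' = c₄') ∨
      (c₂ = c₂' ∧ c₄ = c₄' ∧ c₁ = c₃ ∧ c₁' = c₃') := by
  have k₁₂ := eq_or_eq_of_linked hz₁₂ hz₁₄ hz₃₂ hz₃₄ j₁₂ p₁ p₂ p₃ p₄ p₁' p₂' p₃' p₄' h₁ h₂ h₃ h₄
  have k₁₄ := eq_or_eq_of_linked hz₁₄ hz₁₂ hz₃₄ hz₃₂ j₁₄ p₁' p₄ p₃' p₂ p₁ p₄' p₃ p₂'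
    (fun i => (h₁ i).symm) h₄ (fun i => (h₃ i).symm) h₂
  have k₃₂ := eq_or_eq_of_linked hz₃₂ hz₃₄ hz₁₂ hz₁₄ j₃₂ p₃ p₂' p₁ p₄' p₃' p₂ p₁' p₄
    h₃ (fun i => (h₂ i).symm) h₁ (fun i => (h₄ i).symm)
  have k₃₄ := eq_or_eq_of_linked hz₃₄ hz₃₂ hz₁₄ hz₁₂ j₃₄ p₃' p₄' p₁' p₂' p₃ p₄ p₁ p₂
    (fun i => (h₃ i).symm) (fun i => (h₄ i).symm) (fun i => (h₁ i).symm) (fun i => (h₂ i).symm)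
  have hcases : (c₁ = c₁' ∧ c₃ = c₃') ∨ (c₂ = c₂' ∧ c₄ = c₄') := by
    rw [eq_comm (a := c₁')] at k₁₄
    rw [eq_comm (a := c₂')] at k₃₂
    rw [eq_comm (a := c₃'), eq_comm (a := c₄')] at k₃₄
    tauto
  rcases hcases with ⟨e₁, e₃⟩ | ⟨e₂, e₄⟩
  · subst e₁ e₃
    have hz : z₁₂ = z₁₄ := funext fun i =>
      sideScale_injOn p₁.ne' (hz₁₂ i) (hz₁₄ i) (h₁ i) (o₁ i) (o₁' i)
    have hy : z₃₂ = z₃₄ := funext fun i =>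
      sideScale_injOn p₃.ne' (hz₃₂ i) (hz₃₄ i) (h₃ i) (o₃ i) (o₃' i)
    subst hz hy
    rcases eq_or_eq_of_matching hz₁₂ hz₃₂ j₁₂ j₃₂ p₂ p₂' h₂ h₄ with ⟨a, b⟩ | ⟨a, b⟩
    · exact Or.inl ⟨rfl, a, rfl, b⟩
    · exact Or.inr (Or.inl ⟨rfl, rfl, a, b⟩)
  · subst e₂ e₄
    have hn : ∀ c : ℝ, -(1 / c) = 1 / -c := fun c => by rw [one_div_neg_eq_neg_one_div]
    simp only [hn] at o₂ o₂' o₄ o₄'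
    have hz : z₁₂ = z₃₂ := funext fun i =>
      sideScale_injOn (neg_ne_zero.2 p₂.ne') (hz₁₂ i) (hz₃₂ i) (h₂ i) (o₂ i) (o₂' i)
    have hy : z₁₄ = z₃₄ := funext fun i =>
      sideScale_injOn (neg_ne_zero.2 p₄.ne') (hz₁₄ i) (hz₃₄ i) (h₄ i) (o₄ i) (o₄' i)
    subst hz hy
    rcases eq_or_eq_of_matching (z := fun i => (z₁₂ i)⁻¹) (y := fun i => (z₁₄ i)⁻¹)
      (fun i => inv_pos.2 (hz₁₂ i)) (fun i => inv_pos.2 (hz₁₄ i)) (inv_injective.comp j₁₂)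
      (inv_injective.comp j₁₄) p₁ p₁' (c₄ := c₃) (c₄' := c₃')
      (by simpa only [sideScale_inv, neg_neg] using h₁)
      (by simpa only [sideScale_inv, neg_neg] using h₃) with ⟨a, b⟩ | ⟨a, b⟩
    · exact Or.inl ⟨a, rfl, b, rfl⟩
    · exact Or.inr (Or.inr ⟨rfl, rfl, a, b⟩)

end VertexCondition

/-! ### From vertices to the whole grid. -/

section Grid

theorem iff_of_forall_succ_iff {p : ℕ → Prop} {n : ℕ} (h : ∀ k, k + 1 < n → (p k ↔ p (k + 1)))
    {a b : ℕ} (ha : a < n) (hb : b < n) : p a ↔ p b := by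
  have h0 : ∀ k, k < n → (p 0 ↔ p k) := by
    intro k
    induction k with
    | zero => exact fun _ => Iff.rfl
    | succ k ih => exact fun hk => (ih (by omega)).trans (h k hk)
  exact (h0 a ha).symm.trans (h0 b hb)

/-- Local alternatives at all inner vertices of a grid combine to a global one. -/
theorem grid_trichotomy {m n : ℕ} {h v : ℕ → ℕ → ℝ}
    (H : ∀ i j, i + 1 < m → j + 1 < n →
      (h (i + 1) (j + 1) = 1 / h (i + 1) j ∧ v (i + 1) (j + 1) = 1 / v i (j + 1) ∧
        h i (j + 1) = 1 / h i j ∧ v (i + 1) j = 1 / v i j) ∨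
      (h (i + 1) (j + 1) = 1 / h (i + 1) j ∧ h i (j + 1) = 1 / h i j ∧
        v (i + 1) (j + 1) = v (i + 1) j ∧ v i (j + 1) = v i j) ∨
      (v (i + 1) (j + 1) = 1 / v i (j + 1) ∧ v (i + 1) j = 1 / v i j ∧
        h (i + 1) (j + 1) = h i (j + 1) ∧ h (i + 1) j = h i j)) :
    (∀ i j, i < m → j + 1 < n → h i (j + 1) = 1 / h i j ∧ v i (j + 1) = v i j) ∨
      (∀ i j, i + 1 < m → j < n → v (i + 1) j = 1 / v i j ∧ h (i + 1) j = h i j) ∨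
      ((∀ i j, i < m → j + 1 < n → h i (j + 1) = 1 / h i j) ∧
        (∀ i j, i + 1 < m → j < n → v (i + 1) j = 1 / v i j)) := by
  by_cases hn : n ≤ 1
  · exact Or.inl fun i j _ hj => by omega
  by_cases hm : m ≤ 1
  · exact Or.inr (Or.inl fun i j hi _ => by omega)
  by_cases hv : ∀ i j, i + 1 < m → j < n → v (i + 1) j = 1 / v i j
  · by_cases hh : ∀ i j, i < m → j + 1 < n → h i (j + 1) = 1 / h i j
    · exact Or.inr (Or.inr ⟨hh, hv⟩)
    right; left
    push Not at hh
    obtain ⟨i₀, j₀, hi₀, hj₀, hne⟩ := hh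
    -- Each alternative makes the condition at `i` and at `i + 1` equivalent, so one failure spreads
    -- along the strip. It leaves only the third alternative there, which then spreads across all
    -- columns.
    have hrow : ∀ i, i < m → h i (j₀ + 1) ≠ 1 / h i j₀ := by
      intro i hi
      refine (iff_of_forall_succ_iff (p := fun i => h i (j₀ + 1) ≠ 1 / h i j₀) (n := m) ?_ hi₀
        hi).1 hne
      intro k hk
      rcases H k j₀ hk hj₀ with a | a | a
      · exact not_congr (iff_of_true a.2.2.1 a.1)
      · exact not_congr (iff_of_true a.2.1 a.1)
      · simp only [a.2.2.1, a.2.2.2]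
    have hbase : ∀ i, i + 1 < m → v (i + 1) j₀ = 1 / v i j₀ ∧ h (i + 1) j₀ = h i j₀ := by
      intro i hi
      rcases H i j₀ hi hj₀ with a | a | a
      · exact absurd a.1 (hrow _ hi)
      · exact absurd a.1 (hrow _ hi)
      · exact ⟨a.2.1, a.2.2.2⟩
    intro i j hi hj
    refine (iff_of_forall_succ_iff (n := n)
      (p := fun j => v (i + 1) j = 1 / v i j ∧ h (i + 1) j = h i j) ?_
      (by omega : j₀ < n) hj).1 (hbase i hi)
    intro k hk
    rcases H i k hi hk with a | a | a
    · refine and_congr (iff_of_true a.2.2.2 a.2.1) ?_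
      rw [a.1, a.2.2.1, one_div, one_div, inv_inj]
    · rw [a.1, a.2.1, a.2.2.1, a.2.2.2, one_div, one_div, one_div, inv_inj]
    · exact iff_of_true ⟨a.2.1, a.2.2.2⟩ ⟨a.1, a.2.2.1⟩
  · left
    push Not at hv
    obtain ⟨i₀, j₀, hi₀, hj₀, hne⟩ := hv
    have hcol : ∀ j, j < n → v (i₀ + 1) j ≠ 1 / v i₀ j := by
      intro j hj
      refine (iff_of_forall_succ_iff (p := fun j => v (i₀ + 1) j ≠ 1 / v i₀ j) (n := n) ?_ hj₀
        hj).1 hne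
      intro k hk
      rcases H i₀ k hi₀ hk with a | a | a
      · exact not_congr (iff_of_true a.2.2.2 a.2.1)
      · simp only [a.2.2.1, a.2.2.2]
      · exact not_congr (iff_of_true a.2.1 a.1)
    have hbase : ∀ j, j + 1 < n → h i₀ (j + 1) = 1 / h i₀ j ∧ v i₀ (j + 1) = v i₀ j := by
      intro j hj
      rcases H i₀ j hi₀ hj with a | a | a
      · exact absurd a.2.1 (hcol _ hj)
      · exact ⟨a.2.1, a.2.2.2⟩
      · exact absurd a.1 (hcol _ hj)
    intro i j hi hj
    refine (iff_of_forall_succ_iff (n := m)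
      (p := fun i => h i (j + 1) = 1 / h i j ∧ v i (j + 1) = v i j) ?_
      (by omega : i₀ < m) hi).1 (hbase j hj)
    intro k hk
    rcases H k j hk hj with a | a | a
    · refine and_congr (iff_of_true a.2.2.1 a.1) ?_
      rw [a.2.1, a.2.2.2, one_div, one_div, inv_inj]
    · exact iff_of_true ⟨a.2.1, a.2.2.2⟩ ⟨a.1, a.2.2.1⟩
    · rw [a.1, a.2.1, a.2.2.1, a.2.2.2, one_div, one_div, one_div, inv_inj]

end Grid

/-! ### The conditions on a net in terms of face shapes. -/

namespace QuadNet

variable {d m n : ℕ}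

local notation "E" => EuclideanSpace ℝ (Fin d)

/-- The points of a net, extended constantly to all pairs of natural numbers. -/
noncomputable def pt (N : QuadNet d m n) (i j : ℕ) : E :=
  N.point ⟨min i m, by omega⟩ ⟨min j n, by omega⟩

theorem point_eq_pt (N : QuadNet d m n) (i : Fin (m + 1)) (j : Fin (n + 1)) :
    N.point i j = N.pt i j := by
  unfold pt
  congr 1 <;> ext <;> simp <;> omega

theorem point_mk (N : QuadNet d m n) {i j : ℕ} (hi : i < m + 1) (hj : j < n + 1) :
    N.point ⟨i, hi⟩ ⟨j, hj⟩ = N.pt i j := N.point_eq_pt _ _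

theorem ext_point {N M : QuadNet d m n} (h : ∀ i j, N.point i j = M.point i j) : N = M := by
  cases N; cases M
  congr
  funext i j
  exact h i j

theorem isConvexQuad_pt (N : QuadNet d m n) {i j : ℕ} (hi : i < m) (hj : j < n) :
    IsConvexQuad (N.pt i j) (N.pt (i + 1) j) (N.pt (i + 1) (j + 1)) (N.pt i (j + 1)) := by
  simpa [point_eq_pt] using N.convex_face ⟨i, hi⟩ ⟨j, hj⟩

theorem faceArea_mk (N : QuadNet d m n) {i j : ℕ} (hi : i < m) (hj : j < n) :
    N.faceArea ⟨i, hi⟩ ⟨j, hj⟩ =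
      quadArea (N.pt i j) (N.pt (i + 1) j) (N.pt (i + 1) (j + 1)) (N.pt i (j + 1)) := by
  simp [faceArea, point_eq_pt]

/-- The functions `h`, `v` record the shapes of all faces of the net. -/
def HasShapes (N : QuadNet d m n) (h v : ℕ → ℕ → ℝ) : Prop :=
  (∀ i j, 0 < h i j) ∧ (∀ i j, 0 < v i j) ∧ ∀ i j, i < m → j < n →
    HasQuadShape (N.pt i j) (N.pt (i + 1) j) (N.pt (i + 1) (j + 1)) (N.pt i (j + 1))
      (h i j) (v i j)

theorem exists_hasShapes (N : QuadNet d m n) : ∃ h v, N.HasShapes h v := by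
  have : ∀ i j, ∃ h v : ℝ, 0 < h ∧ 0 < v ∧ (i < m → j < n →
      HasQuadShape (N.pt i j) (N.pt (i + 1) j) (N.pt (i + 1) (j + 1)) (N.pt i (j + 1)) h v) := by
    intro i j
    by_cases hij : i < m ∧ j < n
    · obtain ⟨h, v, H⟩ := (N.isConvexQuad_pt hij.1 hij.2).exists_shape
      exact ⟨h, v, H.1, H.2.1, fun _ _ => H⟩
    · exact ⟨1, 1, one_pos, one_pos, fun hi hj => absurd ⟨hi, hj⟩ hij⟩
  choose h v hh hv H using this
  exact ⟨h, v, hh, hv, H⟩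

theorem subnet_point (N : QuadNet d m n) (a b p q : ℕ) (hp : p + a ≤ m) (hq : q + b ≤ n)
    (i : Fin (a + 1)) (j : Fin (b + 1)) :
    (N.subnet a b p q hp hq).point i j = N.pt (p + i) (q + j) := by
  exact N.point_mk (by omega) (by omega)

/-- The common edge is the far side of the first face; reading that face from there inverts `h` and
keeps `v`. -/
theorem affineSymmetricOneTwo_iff {N : QuadNet d m n} {h v : ℕ → ℕ → ℝ} (H : N.HasShapes h v)
    {p q : ℕ} (hp : p + 1 ≤ m) (hq : q + 2 ≤ n) :
    (N.subnet 1 2 p q hp hq).AffineSymmetricOneTwo ↔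
      h p (q + 1) = 1 / h p q ∧ v p (q + 1) = v p q := by
  have H₁ := H.2.2 p q (by omega) (by omega)
  have H₂ := H.2.2 p (q + 1) (by omega) (by omega)
  simp only [AffineSymmetricOneTwo, subnet_point]
  exact (H₁.flip.areAffineSymmetric_iff H₂).trans (and_congr eq_comm eq_comm)

theorem affineSymmetricTwoOne_iff {N : QuadNet d m n} {h v : ℕ → ℕ → ℝ} (H : N.HasShapes h v)
    {p q : ℕ} (hp : p + 2 ≤ m) (hq : q + 1 ≤ n) :
    (N.subnet 2 1 p q hp hq).AffineSymmetricTwoOne ↔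
      v (p + 1) q = 1 / v p q ∧ h (p + 1) q = h p q := by
  have H₁ := H.2.2 p q (by omega) (by omega)
  have H₂ := H.2.2 (p + 1) q (by omega) (by omega)
  simp only [AffineSymmetricTwoOne, subnet_point]
  exact (H₁.rotate.areAffineSymmetric_iff H₂.reflect).trans (and_congr eq_comm eq_comm)

theorem one_div_sq_eq_one_div_sq_iff {x y : ℝ} (hx : 0 < x) (hy : 0 < y) :
    1 / (1 / x) ^ 2 = 1 / y ^ 2 ↔ y = 1 / x := by
  rw [one_div (_ ^ 2), one_div (y ^ 2), inv_inj, pow_left_inj₀ (by positivity) hy.le two_ne_zero, eq_comm]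

theorem equalOppositeRatiosOneTwo_iff {N : QuadNet d m n} {h v : ℕ → ℕ → ℝ}
    (H : N.HasShapes h v) {p q : ℕ} (hp : p + 1 ≤ m) (hq : q + 2 ≤ n) :
    (N.subnet 1 2 p q hp hq).EqualOppositeRatiosOneTwo ↔ h p (q + 1) = 1 / h p q := by
  have H₁ := (H.2.2 p q (by omega) (by omega)).flip.oppositeRatio_eq
  have H₂ := (H.2.2 p (q + 1) (by omega) (by omega)).oppositeRatio_eq
  simp only [EqualOppositeRatiosOneTwo, subnet_point]
  rw [← one_div_sq_eq_one_div_sq_iff (H.1 _ _) (H.1 _ _), ← H₁, ← H₂]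
  rfl

theorem equalOppositeRatiosTwoOne_iff {N : QuadNet d m n} {h v : ℕ → ℕ → ℝ}
    (H : N.HasShapes h v) {p q : ℕ} (hp : p + 2 ≤ m) (hq : q + 1 ≤ n) :
    (N.subnet 2 1 p q hp hq).EqualOppositeRatiosTwoOne ↔ v (p + 1) q = 1 / v p q := by
  have H₁ := (H.2.2 p q (by omega) (by omega)).rotate.oppositeRatio_eq
  have H₂ := (H.2.2 (p + 1) q (by omega) (by omega)).reflect.oppositeRatio_eq
  simp only [EqualOppositeRatiosTwoOne, subnet_point]
  rw [← one_div_sq_eq_one_div_sq_iff (H.2.1 _ _) (H.2.1 _ _), ← H₁, ← H₂]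
  rfl

end QuadNet

/-! ### Parallel edges and positive scale factors. -/

section Sides

variable {d : ℕ}

local notation "E" => EuclideanSpace ℝ (Fin d)

theorem HasQuadShape.side_ne_zero {A B C D : E} {h v : ℝ} (H : HasQuadShape A B C D h v) :
    B - A ≠ 0 := by
  obtain ⟨hh, hv, Q, x, y, hli, rfl, rfl, rfl, rfl⟩ := H
  intro h0
  have := (hli.pair_coords_eq (p := -1) (q := 1) (r := 0) (s := 0) (by
    rw [zero_smul, zero_smul, add_zero, ← h0]; module)).2
  norm_num at this

theorem exists_smul_of_parallel {A B A' B' : E}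
    (h : line[ℝ, A, B] ∥ line[ℝ, A', B']) : ∃ a : ℝ, B' - A' = a • (B - A) := by
  rw [AffineSubspace.affineSpan_pair_parallel_iff_vectorSpan_eq, vectorSpan_pair_rev,
    vectorSpan_pair_rev] at h
  have : B' -ᵥ A' ∈ Submodule.span ℝ {B -ᵥ A} := h ▸ Submodule.mem_span_singleton_self _
  obtain ⟨a, ha⟩ := Submodule.mem_span_singleton.1 this
  exact ⟨a, ha.symm⟩

theorem parallel_of_smul {A B A' B' u : E} {a a' : ℝ} (ha : 0 < a) (ha' : 0 < a')
    (h : B - A = a • u) (h' : B' - A' = a' • u) : line[ℝ, A, B] ∥ line[ℝ, A', B'] := by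
  rw [AffineSubspace.affineSpan_pair_parallel_iff_vectorSpan_eq, vectorSpan_pair_rev,
    vectorSpan_pair_rev, vsub_eq_sub, vsub_eq_sub, h, h',
    Submodule.span_singleton_smul_eq (IsUnit.mk0 a ha.ne'),
    Submodule.span_singleton_smul_eq (IsUnit.mk0 a' ha'.ne')]

/-- Parallelism alone allows negative factors. Along an interval a change of sign would make an edge
vanish. -/
theorem exists_pos_smul_of_continuous {I : Set ℝ} (hI : I.OrdConnected) {u : I → E}
    (hu : Continuous u) (hne : ∀ s, u s ≠ 0) (t₀ : I) (hpar : ∀ s, ∃ a : ℝ, u s = a • u t₀)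
    (s : I) : ∃ a : ℝ, 0 < a ∧ u s = a • u t₀ := by
  have : PreconnectedSpace I := isPreconnected_iff_preconnectedSpace.1 hI.isPreconnected
  have hpos : 0 < inner ℝ (u t₀) (u t₀) := real_inner_self_pos.2 (hne t₀)
  obtain ⟨a, ha⟩ := hpar s
  refine ⟨a, ?_, ha⟩
  by_contra! hle
  have hcont : Continuous fun r : I => inner ℝ (u r) (u t₀) := hu.inner continuous_const
  have hmem : (0 : ℝ) ∈ Set.Icc (inner ℝ (u s) (u t₀)) (inner ℝ (u t₀) (u t₀)) := by
    refine ⟨?_, hpos.le⟩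
    rw [ha, real_inner_smul_left]
    exact mul_nonpos_of_nonpos_of_nonneg hle hpos.le
  obtain ⟨r, hr⟩ := intermediate_value_univ s t₀ hcont hmem
  obtain ⟨b, hb⟩ := hpar r
  simp only [hb, real_inner_smul_left] at hr
  have hb0 := (mul_eq_zero.1 hr).resolve_right hpos.ne'
  exact hne r (by rw [hb, hb0, zero_smul])

theorem sub_eq_sub_of_grid {m n : ℕ} {p q : ℕ → ℕ → E}
    (h₁ : ∀ i j, i < m → j ≤ n → p (i + 1) j - p i j = q (i + 1) j - q i j)
    (h₂ : ∀ i j, i ≤ m → j < n → p i (j + 1) - p i j = q i (j + 1) - q i j) {i j : ℕ}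
    (hi : i ≤ m) (hj : j ≤ n) : p i j - p 0 0 = q i j - q 0 0 := by
  have hrow : ∀ i, i ≤ m → p i 0 - p 0 0 = q i 0 - q 0 0 := by
    intro i
    induction i with
    | zero => intro _; rw [sub_self, sub_self]
    | succ i ih =>
      intro hi
      rw [← sub_add_sub_cancel (p (i + 1) 0) (p i 0), ← sub_add_sub_cancel (q (i + 1) 0) (q i 0),
        ih (by omega), h₁ i 0 (by omega) (by omega)]
  induction j with
  | zero => exact hrow i hi
  | succ j ih =>
    rw [← sub_add_sub_cancel (p i (j + 1)) (p i j), ← sub_add_sub_cancel (q i (j + 1)) (q i j),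
      ih (by omega), h₂ i j hi (by omega)]

end Sides

/-! ### Edges of a net; translations as congruences. -/

namespace QuadNet

variable {d m n : ℕ}

local notation "E" => EuclideanSpace ℝ (Fin d)

theorem horizontal_ne_zero (N : QuadNet d m n) (hn : 1 ≤ n) {i j : ℕ} (hi : i < m) (hj : j ≤ n) :
    N.pt (i + 1) j - N.pt i j ≠ 0 := by
  obtain ⟨h, v, -, -, H⟩ := N.exists_hasShapes
  rcases hj.lt_or_eq with hj | rfl
  · exact (H i j hi hj).side_ne_zero
  · have := (H i (j - 1) hi (by omega)).flip.side_ne_zero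
    rwa [Nat.sub_add_cancel hn] at this

theorem vertical_ne_zero (N : QuadNet d m n) (hm : 1 ≤ m) {i j : ℕ} (hi : i ≤ m) (hj : j < n) :
    N.pt i (j + 1) - N.pt i j ≠ 0 := by
  obtain ⟨h, v, -, -, H⟩ := N.exists_hasShapes
  rcases hi.lt_or_eq with hi | rfl
  · exact (H i j hi hj).reflect.side_ne_zero
  · have := (H (i - 1) j (by omega) hj).rotate.side_ne_zero
    rwa [Nat.sub_add_cancel hm] at this

theorem IsParallel.horizontal {N M : QuadNet d m n} (h : N.IsParallel M) {i j : ℕ} (hi : i < m)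
    (hj : j ≤ n) : ∃ a : ℝ, M.pt (i + 1) j - M.pt i j = a • (N.pt (i + 1) j - N.pt i j) := by
  have := h.1 ⟨i, hi⟩ ⟨j, by omega⟩
  simp only [point_eq_pt] at this
  exact exists_smul_of_parallel this

theorem IsParallel.vertical {N M : QuadNet d m n} (h : N.IsParallel M) {i j : ℕ} (hi : i ≤ m)
    (hj : j < n) : ∃ a : ℝ, M.pt i (j + 1) - M.pt i j = a • (N.pt i (j + 1) - N.pt i j) := by
  have := h.2 ⟨i, by omega⟩ ⟨j, hj⟩
  simp only [point_eq_pt] at this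
  exact exists_smul_of_parallel this

theorem isCongruent_of_sides_eq {N M : QuadNet d m n}
    (h₁ : ∀ i j, i < m → j ≤ n → N.pt (i + 1) j - N.pt i j = M.pt (i + 1) j - M.pt i j)
    (h₂ : ∀ i j, i ≤ m → j < n → N.pt i (j + 1) - N.pt i j = M.pt i (j + 1) - M.pt i j) :
    N.IsCongruent M := by
  refine ⟨IsometryEquiv.addRight (M.pt 0 0 - N.pt 0 0), fun i j => ?_⟩
  have := sub_eq_sub_of_grid h₁ h₂ (i := i) (j := j) (by omega) (by omega)
  rw [IsometryEquiv.addRight_apply, point_eq_pt, point_eq_pt, ← sub_add_cancel (N.pt i j) (N.pt 0 0),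
    this]
  abel

end QuadNet

/-! ### Necessity: from a deformation to the trichotomy of shapes. -/

namespace QuadNet

variable {d m n : ℕ}

local notation "E" => EuclideanSpace ℝ (Fin d)

/-- A deformation of a net, described by the scale factors of the sides and the parameters of the
faces. -/
theorem IsDeformable.exists_params {N : QuadNet d m n} (hN : N.IsDeformable) (hm : 1 ≤ m)
    (hn : 1 ≤ n) {h v : ℕ → ℕ → ℝ} (H : N.HasShapes h v) :
    ∃ (ι : Type) (_ : Infinite ι) (a b z : ℕ → ℕ → ι → ℝ),
      (∀ i j s, 0 < a i j s) ∧ (∀ i j s, 0 < b i j s) ∧ (∀ i j s, 0 < z i j s) ∧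
      (∀ i j, i < m → j < n → Function.Injective (z i j)) ∧
      ∀ i j, i < m → j < n → ∀ s, a i j s = sideScale (h i j) (z i j s) ∧
        a i (j + 1) s = sideScale (1 / h i j) (z i j s) ∧
        b i j s = sideScale (-v i j) (z i j s) ∧
        b (i + 1) j s = sideScale (-(1 / v i j)) (z i j s) := by
  obtain ⟨I, F, hI, hnt, ⟨t₀, rfl⟩, hcont, hpar, harea, hcong⟩ := hN
  have hcont' : ∀ i j, Continuous fun t : I => (F t).pt i j := fun i j => hcont _ _
  have hinf : Infinite I := by
    obtain ⟨x, hx, y, hy, hxy⟩ := hnt.exists_lt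
    exact Set.infinite_coe_iff.2 ((Set.Icc_infinite hxy).mono (hI.out hx hy))
  have ha : ∀ i j (s : I), ∃ a : ℝ, 0 < a ∧ (i < m → j ≤ n →
      (F s).pt (i + 1) j - (F s).pt i j = a • ((F t₀).pt (i + 1) j - (F t₀).pt i j)) := by
    intro i j s
    by_cases hij : i < m ∧ j ≤ n
    · obtain ⟨a, h0, h1⟩ := exists_pos_smul_of_continuous hI
        (u := fun t => (F t).pt (i + 1) j - (F t).pt i j)
        ((hcont' _ _).sub (hcont' _ _)) (fun s => (F s).horizontal_ne_zero hn hij.1 hij.2) t₀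
        (fun s => (hpar t₀ s).horizontal hij.1 hij.2) s
      exact ⟨a, h0, fun _ _ => h1⟩
    -- The value 1 outside the net keeps the factors positive for all indices.
    · exact ⟨1, one_pos, fun hi hj => absurd ⟨hi, hj⟩ hij⟩
  have hb : ∀ i j (s : I), ∃ b : ℝ, 0 < b ∧ (i ≤ m → j < n →
      (F s).pt i (j + 1) - (F s).pt i j = b • ((F t₀).pt i (j + 1) - (F t₀).pt i j)) := by
    intro i j s
    by_cases hij : i ≤ m ∧ j < n
    · obtain ⟨a, h0, h1⟩ := exists_pos_smul_of_continuous hI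
        (u := fun t => (F t).pt i (j + 1) - (F t).pt i j)
        ((hcont' _ _).sub (hcont' _ _)) (fun s => (F s).vertical_ne_zero hm hij.1 hij.2) t₀
        (fun s => (hpar t₀ s).vertical hij.1 hij.2) s
      exact ⟨a, h0, fun _ _ => h1⟩
    · exact ⟨1, one_pos, fun hi hj => absurd ⟨hi, hj⟩ hij⟩
  choose a ha₀ ha using ha
  choose b hb₀ hb using hb
  have hz : ∀ i j (s : I), ∃ z : ℝ, 0 < z ∧ (i < m → j < n →
      a i j s = sideScale (h i j) z ∧ a i (j + 1) s = sideScale (1 / h i j) z ∧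
        b i j s = sideScale (-v i j) z ∧ b (i + 1) j s = sideScale (-(1 / v i j)) z) := by
    intro i j s
    by_cases hij : i < m ∧ j < n
    · obtain ⟨hi, hj⟩ := hij
      have e := harea s t₀ ⟨i, hi⟩ ⟨j, hj⟩
      rw [faceArea_mk, faceArea_mk] at e
      obtain ⟨z, h0, h1⟩ := (H.2.2 i j hi hj).exists_param (ha₀ i j s) (ha₀ i (j + 1) s)
        (hb₀ i j s) (hb₀ (i + 1) j s) (ha i j s hi hj.le) (ha i (j + 1) s hi hj)
        (hb i j s hi.le hj) (hb (i + 1) j s hi hj) e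
      exact ⟨z, h0, fun _ _ => h1⟩
    · exact ⟨1, one_pos, fun hi hj => absurd ⟨hi, hj⟩ hij⟩
  choose z hz₀ hz using hz
  refine ⟨I, hinf, a, b, z, ha₀, hb₀, hz₀, ?_, fun i j hi hj s => hz i j s hi hj⟩
  -- If one face has equal parameters at `s` and `t`, `sideScale_injOn` carries the equality across
  -- common edges to all faces. Then all edge vectors agree and the nets are translates.
  intro i₀ j₀ hi₀ hj₀ s t hst
  by_contra hne
  refine hcong s t hne ?_
  have hcol : ∀ i, i < m → ∀ j j', j < n → j' < n →
      (z i j s = z i j t ↔ z i j' s = z i j' t) := by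
    intro i hi j j' hj hj'
    refine iff_of_forall_succ_iff (p := fun j => z i j s = z i j t) (n := n) ?_ hj hj'
    intro k hk
    have es := hz i k s hi (by omega)
    have et := hz i k t hi (by omega)
    have es' := hz i (k + 1) s hi hk
    have et' := hz i (k + 1) t hi hk
    have hh := H.1 i k
    have hh' := H.1 i (k + 1)
    constructor
    · intro e
      refine sideScale_injOn hh'.ne' (hz₀ _ _ _) (hz₀ _ _ _) ?_ (es'.2.1 ▸ ha₀ _ _ _)
        (et'.2.1 ▸ ha₀ _ _ _)
      rw [← es'.1, ← et'.1, es.2.1, et.2.1, e]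
    · intro e
      refine sideScale_injOn (one_div_ne_zero hh.ne') (hz₀ _ _ _) (hz₀ _ _ _) ?_ ?_ ?_
      · rw [← es.2.1, ← et.2.1, es'.1, et'.1, e]
      · rw [one_div_one_div]; exact es.1 ▸ ha₀ _ _ _
      · rw [one_div_one_div]; exact et.1 ▸ ha₀ _ _ _
  have hrow : ∀ j, j < n → ∀ i i', i < m → i' < m →
      (z i j s = z i j t ↔ z i' j s = z i' j t) := by
    intro j hj i i' hi hi'
    refine iff_of_forall_succ_iff (p := fun i => z i j s = z i j t) (n := m) ?_ hi hi'
    intro k hk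
    have es := hz k j s (by omega) hj
    have et := hz k j t (by omega) hj
    have es' := hz (k + 1) j s hk hj
    have et' := hz (k + 1) j t hk hj
    have hh := H.2.1 k j
    have hh' := H.2.1 (k + 1) j
    constructor
    · intro e
      refine sideScale_injOn (neg_ne_zero.2 hh'.ne') (hz₀ _ _ _) (hz₀ _ _ _) ?_ ?_ ?_
      · rw [← es'.2.2.1, ← et'.2.2.1, es.2.2.2, et.2.2.2, e]
      · rw [one_div_neg_eq_neg_one_div]; exact es'.2.2.2 ▸ hb₀ _ _ _
      · rw [one_div_neg_eq_neg_one_div]; exact et'.2.2.2 ▸ hb₀ _ _ _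
    · intro e
      refine sideScale_injOn (neg_ne_zero.2 (one_div_ne_zero hh.ne')) (hz₀ _ _ _) (hz₀ _ _ _)
        ?_ ?_ ?_
      · rw [← es.2.2.2, ← et.2.2.2, es'.2.2.1, et'.2.2.1, e]
      · rw [one_div_neg_eq_neg_one_div, one_div_one_div]; exact es.2.2.1 ▸ hb₀ _ _ _
      · rw [one_div_neg_eq_neg_one_div, one_div_one_div]; exact et.2.2.1 ▸ hb₀ _ _ _
  have hall : ∀ i j, i < m → j < n → z i j s = z i j t := fun i j hi hj =>
    (hcol i hi j₀ j hj₀ hj).1 ((hrow j₀ hj₀ i₀ i hi₀ hi).1 hst)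
  refine isCongruent_of_sides_eq ?_ ?_
  · intro i j hi hj
    rw [ha i j s hi hj, ha i j t hi hj]
    congr 1
    -- An edge with `j = n` is only the far side of the face with second index `n - 1`.
    rcases hj.lt_or_eq with hj' | rfl
    · rw [(hz i j s hi hj').1, (hz i j t hi hj').1, hall i j hi hj']
    · have es := (hz i (j - 1) s hi (by omega)).2.1
      have et := (hz i (j - 1) t hi (by omega)).2.1
      rw [Nat.sub_add_cancel hn] at es et
      rw [es, et, hall i (j - 1) hi (by omega)]
  · intro i j hi hj
    rw [hb i j s hi hj, hb i j t hi hj]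
    congr 1
    rcases hi.lt_or_eq with hi' | rfl
    · rw [(hz i j s hi' hj).2.2.1, (hz i j t hi' hj).2.2.1, hall i j hi' hj]
    · have es := (hz (i - 1) j s (by omega) hj).2.2.2
      have et := (hz (i - 1) j t (by omega) hj).2.2.2
      rw [Nat.sub_add_cancel hm] at es et
      rw [es, et, hall (i - 1) j (by omega) hj]

theorem IsDeformable.shapes_trichotomy {N : QuadNet d m n} (hN : N.IsDeformable) (hm : 1 ≤ m)
    (hn : 1 ≤ n) {h v : ℕ → ℕ → ℝ} (H : N.HasShapes h v) :
    (∀ i j, i < m → j + 1 < n → h i (j + 1) = 1 / h i j ∧ v i (j + 1) = v i j) ∨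
      (∀ i j, i + 1 < m → j < n → v (i + 1) j = 1 / v i j ∧ h (i + 1) j = h i j) ∨
      ((∀ i j, i < m → j + 1 < n → h i (j + 1) = 1 / h i j) ∧
        (∀ i j, i + 1 < m → j < n → v (i + 1) j = 1 / v i j)) := by
  obtain ⟨ι, _, a, b, z, ha, hb, hz, hinj, heq⟩ := hN.exists_params hm hn H
  obtain ⟨hh, hv, -⟩ := H
  refine grid_trichotomy fun i j hi hj => ?_
  have e₁₂ := heq (i + 1) (j + 1) hi hj
  have e₁₄ := heq (i + 1) j hi (by omega)
  have e₃₂ := heq i (j + 1) (by omega) hj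
  have e₃₄ := heq i j (by omega) (by omega)
  -- The primed parameters are reciprocals because they are read at far sides of faces.
  have key := vertex_trichotomy (hz (i + 1) (j + 1)) (hz (i + 1) j) (hz i (j + 1)) (hz i j)
    (hinj _ _ hi hj) (hinj _ _ hi (by omega)) (hinj _ _ (by omega) hj)
    (hinj _ _ (by omega) (by omega))
    (hh (i + 1) (j + 1)) (hv (i + 1) (j + 1)) (hh i (j + 1)) (hv (i + 1) j)
    (one_div_pos.2 (hh (i + 1) j)) (one_div_pos.2 (hv i (j + 1))) (one_div_pos.2 (hh i j))
    (one_div_pos.2 (hv i j))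
    (fun s => by rw [← (e₁₂ s).1, ← (e₁₄ s).2.1])
    (fun s => by rw [← (e₁₂ s).2.2.1, ← (e₃₂ s).2.2.2])
    (fun s => by rw [← (e₃₂ s).1, ← (e₃₄ s).2.1])
    (fun s => by rw [← (e₁₄ s).2.2.1, ← (e₃₄ s).2.2.2])
    (fun s => by rw [← (e₁₂ s).2.1]; exact ha _ _ _)
    (fun s => by rw [one_div_one_div, ← (e₁₄ s).1]; exact ha _ _ _)
    (fun s => by rw [← (e₁₂ s).2.2.2]; exact hb _ _ _)
    (fun s => by rw [one_div_one_div, ← (e₃₂ s).2.2.1]; exact hb _ _ _)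
    (fun s => by rw [← (e₃₂ s).2.1]; exact ha _ _ _)
    (fun s => by rw [one_div_one_div, ← (e₃₄ s).1]; exact ha _ _ _)
    (fun s => by rw [← (e₁₄ s).2.2.2]; exact hb _ _ _)
    (fun s => by rw [one_div_one_div, ← (e₃₄ s).2.2.1]; exact hb _ _ _)
  rcases key with ⟨h1, h2, h3, h4⟩ | ⟨h1, h2, h3, h4⟩ | ⟨h1, h2, h3, h4⟩
  · exact Or.inl ⟨h1, h2, h3, h4⟩
  · refine Or.inr (Or.inl ⟨h1, h2, h3, ?_⟩)
    rwa [one_div, one_div, inv_inj] at h4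
  · refine Or.inr (Or.inr ⟨h1, h2, h3, ?_⟩)
    rwa [one_div, one_div, inv_inj] at h4

end QuadNet

/-! ### Solving for the parameter of a neighbouring face. -/

section Parameters

theorem sideScale_one (c : ℝ) : sideScale c 1 = 1 := by
  unfold sideScale; ring

theorem continuous_sideScale {c : ℝ} {z : ℝ → ℝ} (hz : Continuous z) (h0 : ∀ t, 0 < z t) :
    Continuous fun t => sideScale c (z t) := by
  unfold sideScale
  exact ((continuous_const.mul hz).add (continuous_const.div hz fun t => (h0 t).ne')).div_const _

theorem exists_sideScale_eq {c : ℝ} (hc : 0 < c) {b : ℝ → ℝ} (hb : Continuous b) (h1 : b 0 = 1) :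
    ∃ z : ℝ → ℝ, Continuous z ∧ (∀ t, 0 < z t) ∧ z 0 = 1 ∧
      ∀ᶠ t in nhds 0, sideScale c (z t) = b t := by
  -- The larger root of `(1 + c) z ^ 2 - 2 b z + (1 - c) = 0`, equal to 1 at `b = 1` because `c >
  -- 0`. The maximum with `1 / 2` keeps it positive for all `t` and is inactive near 0.
  refine ⟨fun t => (max (b t) (1 / 2) + √(b t ^ 2 - 1 + c ^ 2)) / (1 + c), ?_, ?_, ?_, ?_⟩
  · exact ((hb.max continuous_const).add
      (((hb.pow 2).sub continuous_const).add continuous_const).sqrt).div_const _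
  · intro t
    have : 0 < max (b t) (1 / 2) := lt_of_lt_of_le (by norm_num) (le_max_right _ _)
    positivity
  · simp only [h1]
    rw [one_pow, sub_self, zero_add, Real.sqrt_sq hc.le, max_eq_left (by norm_num),
      div_self (by positivity)]
  · have e₁ : ∀ᶠ t in nhds 0, 1 / 2 < b t :=
      (hb.tendsto 0).eventually_const_lt (by rw [h1]; norm_num)
    have e₂ : ∀ᶠ t in nhds 0, 0 < b t ^ 2 - 1 + c ^ 2 := by
      have hcont : Continuous fun t => b t ^ 2 - 1 + c ^ 2 :=
        ((hb.pow 2).sub continuous_const).add continuous_const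
      exact (hcont.tendsto 0).eventually_const_lt (by rw [h1]; simp; positivity)
    filter_upwards [e₁, e₂] with t h₁ h₂
    have hs := Real.sq_sqrt h₂.le
    have hp : 0 < b t + √(b t ^ 2 - 1 + c ^ 2) := by
      have := Real.sqrt_nonneg (b t ^ 2 - 1 + c ^ 2); linarith
    rw [max_eq_left h₁.le]
    unfold sideScale
    field_simp
    linear_combination hs

theorem exists_param_chain (c c' : ℕ → ℝ) (hc' : ∀ i, 0 < c' i) :
    ∃ Z : ℕ → ℝ → ℝ, (∀ i, Continuous (Z i)) ∧ (∀ i t, 0 < Z i t) ∧ (∀ i, Z i 0 = 1) ∧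
      Z 0 = Real.exp ∧
      ∀ i, ∀ᶠ t in nhds 0, sideScale (c i) (Z i t) = sideScale (c' (i + 1)) (Z (i + 1) t) := by
  let T := {z : ℝ → ℝ // Continuous z ∧ (∀ t, 0 < z t) ∧ z 0 = 1}
  have step : ∀ (i : ℕ) (z : T), ∃ z' : T, ∀ᶠ t in nhds 0,
      sideScale (c i) (z.1 t) = sideScale (c' (i + 1)) (z'.1 t) := by
    rintro i ⟨z, h1, h2, h3⟩
    obtain ⟨z', h1', h2', h3', h⟩ := exists_sideScale_eq (hc' (i + 1))
      (continuous_sideScale (c := c i) h1 h2) (by rw [h3, sideScale_one])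
    exact ⟨⟨z', h1', h2', h3'⟩, h.mono fun t ht => ht.symm⟩
  choose next hnext using step
  let Z : ℕ → T := fun i => Nat.rec ⟨Real.exp, Real.continuous_exp, Real.exp_pos, Real.exp_zero⟩
    (fun i z => next i z) i
  exact ⟨fun i => (Z i).1, fun i => (Z i).2.1, fun i => (Z i).2.2.1, fun i => (Z i).2.2.2, rfl,
    fun i => hnext i (Z i)⟩

end Parameters

/-! ### Integrating scaled edges to a grid of points. -/

section Closure

variable {d : ℕ}

local notation "E" => EuclideanSpace ℝ (Fin d)

theorem HasQuadShape.closing {A B C D : E} {h v z : ℝ} (H : HasQuadShape A B C D h v)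
    (hz : 0 < z) :
    sideScale h z • (B - A) + sideScale (-(1 / v)) z • (C - B) =
      sideScale (-v) z • (D - A) + sideScale (1 / h) z • (C - D) := by
  obtain ⟨hh, hv, Q, x, y, -, rfl, rfl, rfl, rfl⟩ := H
  obtain ⟨P, S, -, -, hL⟩ := exists_hyperbolic_coords hz
  rw [hL, hL, hL, hL, ← sub_eq_zero]
  have f₁ : -(P + h * S) - (P + -(1 / v) * S) * (h * v) + (P + -v * S) +
      (P + 1 / h * S) * (h * v) = 0 := by field_simp; ring
  have f₂ : (P + h * S) - (P + -(1 / v) * S) + (P + -v * S) * (h / v) -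
      (P + 1 / h * S) * (h / v) = 0 := by field_simp; ring
  have hcomb : ∀ r s : ℝ, r = 0 → s = 0 → r • x + s • y = 0 := by
    rintro _ _ rfl rfl; simp
  refine Eq.trans ?_ (hcomb _ _ f₁ f₂)
  module

/-- The points of a grid with a prescribed corner and prescribed multiples of the sides of a given
grid. -/
noncomputable def scaledGrid (p : ℕ → ℕ → E) (a b : ℕ → ℕ → ℝ) (i j : ℕ) : E :=
  p 0 0 + ∑ k ∈ Finset.range i, a k 0 • (p (k + 1) 0 - p k 0) +
    ∑ l ∈ Finset.range j, b i l • (p i (l + 1) - p i l)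

theorem scaledGrid_vertical (p : ℕ → ℕ → E) (a b : ℕ → ℕ → ℝ) (i j : ℕ) :
    scaledGrid p a b i (j + 1) - scaledGrid p a b i j = b i j • (p i (j + 1) - p i j) := by
  unfold scaledGrid
  rw [Finset.sum_range_succ]
  abel

/-- The points are defined by paths along the bottom row and then upwards; closing of each cell
carries the horizontal edges from row to row. -/
theorem scaledGrid_horizontal {p : ℕ → ℕ → E} {a b : ℕ → ℕ → ℝ} {m n : ℕ}
    (h : ∀ i j, i < m → j < n →
      a i j • (p (i + 1) j - p i j) + b (i + 1) j • (p (i + 1) (j + 1) - p (i + 1) j) =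
        b i j • (p i (j + 1) - p i j) + a i (j + 1) • (p (i + 1) (j + 1) - p i (j + 1)))
    {i j : ℕ} (hi : i < m) (hj : j ≤ n) :
    scaledGrid p a b (i + 1) j - scaledGrid p a b i j = a i j • (p (i + 1) j - p i j) := by
  induction j with
  | zero =>
    unfold scaledGrid
    rw [Finset.sum_range_succ]
    simp only [Finset.range_zero, Finset.sum_empty]
    abel
  | succ j ih =>
    have h1 := scaledGrid_vertical p a b (i + 1) j
    have h2 := scaledGrid_vertical p a b i j
    rw [sub_eq_iff_eq_add] at h1 h2
    rw [h1, h2, add_sub_add_comm, ih (by omega), add_comm, ← add_sub_assoc, sub_eq_iff_eq_add',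
      h i j hi (by omega)]

end Closure

/-! ### Sufficiency: nets built from compatible parameters. -/

namespace QuadNet

variable {d m n : ℕ}

local notation "E" => EuclideanSpace ℝ (Fin d)

/-- Finitely many conditions hold eventually at 0, hence on a common interval, where the scaled
edges close up and `HasQuadShape.of_param` applies to every face. -/
theorem isDeformable_of_params {N : QuadNet d m n} (hm : 1 ≤ m) (hn : 1 ≤ n) {h v : ℕ → ℕ → ℝ}
    (H : N.HasShapes h v) {z : ℕ → ℕ → ℝ → ℝ} (hcont : ∀ i j, Continuous (z i j))
    (hpos : ∀ i j t, 0 < z i j t) (hone : ∀ i j, z i j 0 = 1) (hinj : Function.Injective (z 0 0))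
    (hh : ∀ i j, i < m → j + 1 < n → ∀ᶠ t in nhds 0,
      sideScale (1 / h i j) (z i j t) = sideScale (h i (j + 1)) (z i (j + 1) t))
    (hv : ∀ i j, i + 1 < m → j < n → ∀ᶠ t in nhds 0,
      sideScale (-(1 / v i j)) (z i j t) = sideScale (-v (i + 1) j) (z (i + 1) j t)) :
    N.IsDeformable := by
  have hscale : ∀ c i j, ∀ᶠ t in nhds 0, 0 < sideScale c (z i j t) := fun c i j =>
    ((continuous_sideScale (hcont i j) (hpos i j)).tendsto 0).eventually_const_lt
      (by rw [hone, sideScale_one]; exact one_pos)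
  have hgood : ∀ᶠ t in nhds (0 : ℝ), ∀ i ∈ Finset.range m, ∀ j ∈ Finset.range n,
      0 < sideScale (h i j) (z i j t) ∧ 0 < sideScale (1 / h i j) (z i j t) ∧
      0 < sideScale (-v i j) (z i j t) ∧ 0 < sideScale (-(1 / v i j)) (z i j t) ∧
      (j + 1 < n → sideScale (1 / h i j) (z i j t) = sideScale (h i (j + 1)) (z i (j + 1) t)) ∧
      (i + 1 < m →
        sideScale (-(1 / v i j)) (z i j t) = sideScale (-v (i + 1) j) (z (i + 1) j t)) := by
    refine (Filter.eventually_all_finset _).2 fun i hi =>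
      (Filter.eventually_all_finset _).2 fun j hj => ?_
    have hi' := Finset.mem_range.1 hi
    have hj' := Finset.mem_range.1 hj
    exact (hscale _ _ _).and ((hscale _ _ _).and ((hscale _ _ _).and ((hscale _ _ _).and
      ((Filter.eventually_imp_distrib_left.2 fun h' => hh i j hi' h').and
        (Filter.eventually_imp_distrib_left.2 fun h' => hv i j h' hj')))))
  obtain ⟨ε, hε, hball⟩ := Metric.eventually_nhds_iff.1 hgood
  let a : ℝ → ℕ → ℕ → ℝ := fun t i j => if j < n then sideScale (h i j) (z i j t) else
    sideScale (1 / h i (j - 1)) (z i (j - 1) t)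
  let b : ℝ → ℕ → ℕ → ℝ := fun t i j => if i < m then sideScale (-v i j) (z i j t) else
    sideScale (-(1 / v (i - 1) j)) (z (i - 1) j t)
  have hacont : ∀ i j, Continuous fun t => a t i j := by
    intro i j
    simp only [a]
    split_ifs <;> exact continuous_sideScale (hcont _ _) (hpos _ _)
  have hbcont : ∀ i j, Continuous fun t => b t i j := by
    intro i j
    simp only [b]
    split_ifs <;> exact continuous_sideScale (hcont _ _) (hpos _ _)
  have hmem : ∀ t : Set.Icc 0 (ε / 2), dist t.1 0 < ε := by
    intro t
    rw [Real.dist_0_eq_abs, abs_of_nonneg t.2.1]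
    linarith [t.2.2]
  have hsc : ∀ t : Set.Icc 0 (ε / 2), ∀ i j, i < m → j < n →
      0 < sideScale (h i j) (z i j t) ∧ 0 < sideScale (1 / h i j) (z i j t) ∧
      0 < sideScale (-v i j) (z i j t) ∧ 0 < sideScale (-(1 / v i j)) (z i j t) ∧
      a t i j = sideScale (h i j) (z i j t) ∧ a t i (j + 1) = sideScale (1 / h i j) (z i j t) ∧
      b t i j = sideScale (-v i j) (z i j t) ∧
      b t (i + 1) j = sideScale (-(1 / v i j)) (z i j t) := by
    intro t i j hi hj
    obtain ⟨h1, h2, h3, h4, h5, h6⟩ := hball (hmem t) i (Finset.mem_range.2 hi) j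
      (Finset.mem_range.2 hj)
    refine ⟨h1, h2, h3, h4, if_pos hj, ?_, if_pos hi, ?_⟩
    · by_cases hj' : j + 1 < n
      · rw [h5 hj']; exact if_pos hj'
      · exact if_neg hj'
    · by_cases hi' : i + 1 < m
      · rw [h6 hi']; exact if_pos hi'
      · exact if_neg hi'
  have hapos : ∀ t : Set.Icc 0 (ε / 2), ∀ i j, i < m → j ≤ n → 0 < a t i j := by
    intro t i j hi hj
    rcases hj.lt_or_eq with hj | rfl
    · obtain ⟨h1, -, -, -, h5, -⟩ := hsc t i j hi hj
      rwa [h5]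
    · obtain ⟨-, h2, -, -, -, h6, -⟩ := hsc t i (j - 1) hi (by omega)
      rw [Nat.sub_add_cancel hn] at h6
      rwa [h6]
  have hbpos : ∀ t : Set.Icc 0 (ε / 2), ∀ i j, i ≤ m → j < n → 0 < b t i j := by
    intro t i j hi hj
    rcases hi.lt_or_eq with hi | rfl
    · obtain ⟨-, -, h3, -, -, -, h7, -⟩ := hsc t i j hi hj
      rwa [h7]
    · obtain ⟨-, -, -, h4, -, -, -, h8⟩ := hsc t (i - 1) j (by omega) hj
      rw [Nat.sub_add_cancel hm] at h8
      rwa [h8]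
  let p : ℝ → ℕ → ℕ → E := fun t => scaledGrid N.pt (a t) (b t)
  have hpv : ∀ t i j, p t i (j + 1) - p t i j = b t i j • (N.pt i (j + 1) - N.pt i j) :=
    fun t i j => scaledGrid_vertical _ _ _ i j
  have hph : ∀ t : Set.Icc 0 (ε / 2), ∀ i j, i < m → j ≤ n →
      p t (i + 1) j - p t i j = a t i j • (N.pt (i + 1) j - N.pt i j) := by
    intro t i j hi hj
    refine scaledGrid_horizontal (m := m) (n := n) ?_ hi hj
    intro i j hi hj
    obtain ⟨-, -, -, -, h5, h6, h7, h8⟩ := hsc t i j hi hj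
    rw [h5, h6, h7, h8]
    exact (H.2.2 i j hi hj).closing (hpos _ _ _)
  have hface : ∀ t : Set.Icc 0 (ε / 2), ∀ i j, i < m → j < n →
      IsConvexQuad (p t i j) (p t (i + 1) j) (p t (i + 1) (j + 1)) (p t i (j + 1)) ∧
      quadArea (p t i j) (p t (i + 1) j) (p t (i + 1) (j + 1)) (p t i (j + 1)) =
      quadArea (N.pt i j) (N.pt (i + 1) j) (N.pt (i + 1) (j + 1)) (N.pt i (j + 1)) := by
    intro t i j hi hj
    obtain ⟨h1, h2, h3, h4, h5, h6, h7, h8⟩ := hsc t i j hi hj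
    refine (H.2.2 i j hi hj).of_param (hpos i j t) h1 h2 h3 h4 ?_ ?_ ?_ ?_
    · rw [← h5]; exact hph t i j hi hj.le
    · rw [← h6]; exact hph t i (j + 1) hi hj
    · rw [← h7]; exact hpv t i j
    · rw [← h8]; exact hpv t (i + 1) j
  let F : Set.Icc 0 (ε / 2) → QuadNet d m n := fun t =>
    { point := fun i j => p t i j
      convex_face := fun i j => (hface t i j i.2 j.2).1 }
  refine ⟨Set.Icc 0 (ε / 2), F, Set.ordConnected_Icc, ?_, ⟨⟨0, le_rfl, by positivity⟩, ?_⟩,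
    ?_, ?_, ?_, ?_⟩
  · exact ⟨0, ⟨le_rfl, by positivity⟩, ε / 2, ⟨by positivity, le_rfl⟩, by positivity⟩
  · refine ext_point fun i j => ?_
    have ha0 : ∀ i j, a 0 i j = 1 := by
      intro i j; simp only [a, hone, sideScale_one, ite_self]
    have hb0 : ∀ i j, b 0 i j = 1 := by
      intro i j; simp only [b, hone, sideScale_one, ite_self]
    have hp0 : p 0 0 0 = N.pt 0 0 := by simp [p, scaledGrid]
    have := sub_eq_sub_of_grid (p := p 0) (q := N.pt) (m := m) (n := n)
      (fun i j hi hj => by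
        rw [hph ⟨0, le_rfl, by positivity⟩ i j hi hj, ha0, one_smul])
      (fun i j hi hj => by rw [hpv, hb0, one_smul])
      (i := i) (j := j) (by omega) (by omega)
    rw [hp0] at this
    change p 0 i j = N.point i j
    rw [point_eq_pt]
    exact sub_left_inj.1 this
  · intro i j
    change Continuous fun t : Set.Icc 0 (ε / 2) => p t i j
    have : Continuous fun t : ℝ => p t i j := by
      simp only [p, scaledGrid]
      exact (continuous_const.add (continuous_finsetSum _ fun k _ =>
        (hacont k 0).smul continuous_const)).add (continuous_finsetSum _ fun l _ =>
        (hbcont i l).smul continuous_const)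
    exact this.comp continuous_subtype_val
  · intro s t
    refine ⟨fun i j => ?_, fun i j => ?_⟩
    · exact parallel_of_smul (hapos s i j i.2 (by omega)) (hapos t i j i.2 (by omega))
        (hph s i j i.2 (by omega)) (hph t i j i.2 (by omega))
    · exact parallel_of_smul (hbpos s i j (by omega) j.2) (hbpos t i j (by omega) j.2)
        (hpv s i j) (hpv t i j)
  · intro s t i j
    exact (hface s i j i.2 j.2).2.trans (hface t i j i.2 j.2).2.symm
  -- A congruence preserves the length of the first horizontal edge, which determines `z 0 0` and so
  -- the parameter.
  · rintro s t hst ⟨g, hg⟩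
    apply hst
    have h₁ := hg ⟨1, by omega⟩ ⟨0, by omega⟩
    have h₀ := hg ⟨0, by omega⟩ ⟨0, by omega⟩
    change g (p s 1 0) = p t 1 0 at h₁
    change g (p s 0 0) = p t 0 0 at h₀
    have hd := g.dist_eq (p s 1 0) (p s 0 0)
    rw [h₁, h₀, dist_eq_norm, dist_eq_norm, hph s 0 0 hm (by omega), hph t 0 0 hm (by omega),
      norm_smul, norm_smul, Real.norm_of_nonneg (hapos s 0 0 hm (by omega)).le,
      Real.norm_of_nonneg (hapos t 0 0 hm (by omega)).le] at hd
    have hne : ‖N.pt (0 + 1) 0 - N.pt 0 0‖ ≠ 0 :=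
      norm_ne_zero_iff.2 (N.horizontal_ne_zero hn hm (by omega))
    have ha := mul_right_cancel₀ hne hd
    obtain ⟨-, hs, -, -, hs', -⟩ := hsc s 0 0 hm hn
    obtain ⟨-, ht, -, -, ht', -⟩ := hsc t 0 0 hm hn
    rw [hs', ht'] at ha
    exact Subtype.ext (hinj (sideScale_injOn (H.1 0 0).ne' (hpos _ _ _) (hpos _ _ _) ha.symm
      hs ht))

end QuadNet

/-! ### The equivalence. -/

theorem theorem3p1 (d m n : ℕ) (hm : 1 ≤ m) (hn : 1 ≤ n) (N : QuadNet d m n) :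
    N.IsDeformable ↔
      (((∀ (p q : ℕ) (hp : p + 1 ≤ m) (hq : q + 2 ≤ n),
            (N.subnet 1 2 p q hp hq).AffineSymmetricOneTwo) ∨
          (∀ (p q : ℕ) (hp : p + 2 ≤ m) (hq : q + 1 ≤ n),
            (N.subnet 2 1 p q hp hq).AffineSymmetricTwoOne)) ∨
        ((∀ (p q : ℕ) (hp : p + 1 ≤ m) (hq : q + 2 ≤ n),
            (N.subnet 1 2 p q hp hq).EqualOppositeRatiosOneTwo) ∧
          (∀ (p q : ℕ) (hp : p + 2 ≤ m) (hq : q + 1 ≤ n),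
            (N.subnet 2 1 p q hp hq).EqualOppositeRatiosTwoOne))) := by
  obtain ⟨h, v, H⟩ := N.exists_hasShapes
  simp only [QuadNet.affineSymmetricOneTwo_iff H, QuadNet.affineSymmetricTwoOne_iff H,
    QuadNet.equalOppositeRatiosOneTwo_iff H, QuadNet.equalOppositeRatiosTwoOne_iff H]
  constructor
  · intro hN
    rcases hN.shapes_trichotomy hm hn H with h' | h' | ⟨h', h''⟩
    · exact Or.inl (Or.inl fun p q hp hq => h' p q hp hq)
    · exact Or.inl (Or.inr fun p q hp hq => h' p q hp hq)
    · exact Or.inr ⟨fun p q hp hq => h' p q hp hq, fun p q hp hq => h'' p q hp hq⟩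
  · rintro ((h' | h') | ⟨h', h''⟩)
    · have hv : ∀ i, i < m → ∀ j, j < n → v i j = v i 0 := by
        intro i hi j
        induction j with
        | zero => exact fun _ => rfl
        | succ j ih => exact fun hj => (h' i j hi hj).2.trans (ih (by omega))
      obtain ⟨Z, hc, hp, h1, h0, hZ⟩ := exists_param_chain (fun i => 1 / v i 0) (fun i => v i 0)
        fun i => H.2.1 i 0
      -- The parameter is constant in `j`. The chain runs with positive coefficients, whereas the
      -- edges to be matched carry `-v`; inversion changes this sign.
      refine QuadNet.isDeformable_of_params hm hn H (z := fun i _ t => (Z i t)⁻¹)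
        (fun i _ => (hc i).inv₀ fun t => (hp i t).ne') (fun i _ t => inv_pos.2 (hp i t))
        (fun i _ => by rw [h1, inv_one]) ?_ ?_ ?_
      · intro s t hst
        exact Real.exp_injective (by simpa [h0] using hst)
      · intro i j hi hj
        exact Filter.Eventually.of_forall fun t => by rw [(h' i j hi hj).1]
      · intro i j hi hj
        filter_upwards [hZ i] with t ht
        rw [sideScale_inv, sideScale_inv, neg_neg, neg_neg, hv i (by omega) j hj,
          hv (i + 1) hi j hj, ht]
    · have hh : ∀ j, j < n → ∀ i, i < m → h i j = h 0 j := by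
        intro j hj i
        induction i with
        | zero => exact fun _ => rfl
        | succ i ih => exact fun hi => (h' i j hi hj).2.trans (ih (by omega))
      obtain ⟨Z, hc, hp, h1, h0, hZ⟩ := exists_param_chain (fun j => 1 / h 0 j) (fun j => h 0 j)
        fun j => H.1 0 j
      refine QuadNet.isDeformable_of_params hm hn H (z := fun _ j t => Z j t)
        (fun _ j => hc j) (fun _ j t => hp j t) (fun _ j => h1 j) ?_ ?_ ?_
      · intro s t hst
        exact Real.exp_injective (by simpa [h0] using hst)
      · intro i j hi hj
        filter_upwards [hZ j] with t ht
        rw [hh j (by omega) i hi, hh (j + 1) hj i hi, ht]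
      · intro i j hi hj
        exact Filter.Eventually.of_forall fun t => by rw [(h' i j hi hj).1]
    -- The coefficients agree at every inner edge, so one common parameter is compatible everywhere.
    · refine QuadNet.isDeformable_of_params hm hn H (z := fun _ _ => Real.exp)
        (fun _ _ => Real.continuous_exp) (fun _ _ => Real.exp_pos) (fun _ _ => Real.exp_zero)
        Real.exp_injective ?_ ?_
      · intro i j hi hj
        exact Filter.Eventually.of_forall fun t => by rw [h' i j hi hj]
      · intro i j hi hj
        exact Filter.Eventually.of_forall fun t => by rw [h'' i j hi hj]
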